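/- Let $V$ be a $6$-dimensional complex vector space and let $G(2,V)\subset\mathbb{P}(\bigwedge^2V)$ be the Grassmannian of $2$-dimensional subspaces of $V$ in its Plücker embedding, i.e. the set of classes $[v\wedge w]$ of nonzero decomposable bivectors (points of projective spaces are one-dimensional subspaces). Let $\mathcal{U}_5\subset G(5,\bigwedge^2V)$ be the set of $5$-dimensional subspaces $W_5\subset\bigwedge^2V$ such that $\mathbb{P}(W_5)\cap G(2,V)$ consists of exactly $5$ distinct points, and these are linearly independent. Then there is a nonempty Zariski open subset of the Grassmannian $G(4,\bigwedge^2V)$ such that every $4$-dimensional subspace $W_4$ in it has the following properties. (1) There is a unique $W_5\in\mathcal{U}_5$ containing $W_4$. (2) $\mathbb{P}(W_4)\cap G(2,V)=\emptyset$, and for the projection $\pi\colon G(2,V)\to\mathbb{P}\big((\bigwedge^2V)/W_4\big)$ with center $\mathbb{P}(W_4)\cong\mathbb{P}_3$ there is a unique point $y$ whose fibre $\pi^{-1}(y)$ consists of exactly $5$ distinct points. -/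

import Mathlib

open scoped LinearAlgebra.Projectivization

noncomputable section

namespace Secant

/-- The Zariski topology on (the set of points of) a complex vector space `E`: its basic open sets
are the loci where a polynomial function does not vanish. Polynomial functions are the polynomials
in the linear functionals on `E`; the basic open sets are closed under finite intersection, since
polynomials can be multiplied. -/
@[reducible] def zariskiTopology (E : Type*) [AddCommGroup E] [Module ℂ E] : TopologicalSpace E :=
  TopologicalSpace.generateFrom
    {U : Set E | ∃ p : MvPolynomial (Module.Dual ℂ E) ℂ,
      U = {x : E | MvPolynomial.eval (fun φ : Module.Dual ℂ E => φ x) p ≠ 0}}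

/-- The Grassmannian `G(k, E)` of `k`-dimensional vector subspaces of `E`. -/
def Gr (k : ℕ) (E : Type*) [AddCommGroup E] [Module ℂ E] : Type _ :=
  {W : Submodule ℂ E // Module.finrank ℂ W = k}

/-- The subspace spanned by a frame, i.e. by a `k`-tuple of linearly independent vectors. -/
def frameSpan (k : ℕ) (E : Type*) [AddCommGroup E] [Module ℂ E]
    (w : {w : Fin k → E // LinearIndependent ℂ w}) : Gr k E :=
  ⟨Submodule.span ℂ (Set.range w.1), by simpa using finrank_span_eq_card w.2⟩

/-- The Zariski topology on the Grassmannian `G(k, E)` of a finite-dimensional `E`: it is the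
quotient of the open subset of frames in the affine space `E ^ k` by the action of `GL k`, so a set
of subspaces is open if and only if the set of all frames of its members is open. -/
@[reducible] def grassmannianTopology (k : ℕ) (E : Type*) [AddCommGroup E] [Module ℂ E] :
    TopologicalSpace (Gr k E) :=
  TopologicalSpace.coinduced (frameSpan k E)
    (TopologicalSpace.induced Subtype.val (zariskiTopology (Fin k → E)))

/-- The property `P` holds for a general `k`-dimensional subspace of `E`: it holds on a nonempty
Zariski open subset of the (irreducible) Grassmannian `G(k, E)`. -/
def ForGeneral (k : ℕ) (E : Type*) [AddCommGroup E] [Module ℂ E] (P : Gr k E → Prop) : Prop :=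
  ∃ U : Set (Gr k E), (grassmannianTopology k E).IsOpen U ∧ U.Nonempty ∧ ∀ W ∈ U, P W

/-- The projectivization `ℙ(W)` of a subspace `W` of `E`, as a set of points of `ℙ(E)`
(points are lines through the origin). -/
def projOf {E : Type*} [AddCommGroup E] [Module ℂ E] (W : Submodule ℂ E) : Set (ℙ ℂ E) :=
  {x : ℙ ℂ E | x.submodule ≤ W}

/-- The Grassmannian `G(2, V)` in its Plücker embedding in `ℙ(⋀² V)`: the points represented by
a decomposable bivector `v ∧ w`. (It is nonzero, since it spans a line.) -/
def pluckerGr (V : Type*) [AddCommGroup V] [Module ℂ V] : Set (ℙ ℂ (⋀[ℂ]^2 V)) :=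
  {x | ∃ v w : V, x.submodule = Submodule.span ℂ {exteriorPower.ιMulti ℂ 2 ![v, w]}}

/-- The set `𝒰₅` of five-dimensional subspaces of `⋀² V` whose projectivization meets `G(2, V)` in
exactly five points, which are linearly independent (hence distinct). -/
def fiveSecant (V : Type*) [AddCommGroup V] [Module ℂ V] : Set (Gr 5 (⋀[ℂ]^2 V)) :=
  {W | ∃ u : Fin 5 → ℙ ℂ (⋀[ℂ]^2 V),
    Projectivization.Independent u ∧ projOf W.1 ∩ pluckerGr V = Set.range u}

/-- The linear projection `ℙ(E) ∖ ℙ(W) → ℙ(E / W)` with center `ℙ(W)`. -/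
def projectFrom {E : Type*} [AddCommGroup E] [Module ℂ E] (W : Submodule ℂ E)
    (x : {x : ℙ ℂ E // x ∉ projOf W}) : ℙ ℂ (E ⧸ W) :=
  Projectivization.mk ℂ (W.mkQ x.1.rep) (fun h => x.2 (by
    have h2 : x.1.rep ∈ W := by simpa using h
    change x.1.submodule ≤ W
    rw [Projectivization.submodule_eq, Submodule.span_singleton_le_iff_mem]
    exact h2))

end Secant

end

/-! Five points of the 8-dimensional G(2,V) together with a hyperplane W₄ of their span depend on 40
+ 4 = 44 parameters, and 44 is also the dimension of G(4,15). So one expects a general W₄ to lie in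
finitely many five-secant spaces. It remains to show that there is at least one (dominance) and at
most one (uniqueness).

Dominance. Four linear combinations of five decomposable bivectors give a polynomial map `comb` from
ℂ^80 to the 60-dimensional (⋀²V)⁴. It is a submersion at the explicit configuration `specialParam`
(`range_fderiv_comb`). By Chevalley's theorem and the Nullstellensatz, the image of any locus N ≠ 0
containing that point then contains a nonempty Zariski open set
(`exists_open_subset_image_of_fderiv_surjective`).

Uniqueness. Write xy for the symmetric product x ∧ y in ⋀⁴V, so that points of G(2,V) have square
zero. Let W₄ lie in the span of ω₀, …, ω₄ and satisfy `IsGeneric`. Then Sym²W₄ embeds in ⋀⁴V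
(`sum_dual_mul_dual`). If W ⊇ W₄ is five-dimensional with five non-proportional square-zero vectors,
scale these to v₀, …, v₄ in one affine hyperplane parallel to W₄. The differences y = vᵢ - v₀ lie in
W₄ and solve y² = -2v₀y. Distinct nonzero solutions of such an equation are independent
(`linearIndependent_of_sq_eq`), so they form a basis of W₄, and v₀W₄ lies in the span of the
products ωⱼωₖ. Genericity then puts v₀ in the span of ω, so W is that span (`eq_span_of_five`). Only
distinctness of the five points is used, so the same argument settles the fibres of the projection.

The conditions in `IsGeneric` follow from the independence of polynomial families of vectors, hence
hold on an open set once they hold at `specialParam` (`exists_polynomial_isGeneric`). -/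

namespace Secant

/-! ### Images of polynomial maps: Chevalley's theorem and submersions. -/

section Chevalley

/-- A constructible subset of the spectrum of a domain either contains or misses a nonempty basic
open subset, according to whether it contains the generic point. -/
theorem exists_basicOpen_subset_of_isConstructible {A : Type*} [CommRing A] [IsDomain A]
    {s : Set (PrimeSpectrum A)} (hs : Topology.IsConstructible s) :
    (⊥ ∈ s → ∃ f : A, f ≠ 0 ∧ (PrimeSpectrum.basicOpen f : Set (PrimeSpectrum A)) ⊆ s) ∧
    (⊥ ∉ s → ∃ f : A, f ≠ 0 ∧ (PrimeSpectrum.basicOpen f : Set (PrimeSpectrum A)) ⊆ sᶜ) := by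
  induction hs using Topology.IsConstructible.empty_union_induction with
  | open_retrocompact U hU _ =>
    refine ⟨fun h => ?_, fun h => ⟨1, one_ne_zero, fun q _ hqU => h ?_⟩⟩
    · obtain ⟨_, ⟨f, rfl⟩, hf, hfU⟩ :=
        PrimeSpectrum.isTopologicalBasis_basic_opens.exists_subset_of_mem_open h hU
      refine ⟨f, ?_, hfU⟩
      rintro rfl
      simp at hf
    -- An open set that misses the generic point is empty, as every point is a specialization of it.
    · have : (⊥ : PrimeSpectrum A) ⤳ q :=
        (PrimeSpectrum.le_iff_specializes _ _).1 bot_le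
      exact this.mem_open hU hqU
  | union s hs t ht hs' ht' =>
    refine ⟨?_, fun h => ?_⟩
    · rintro (h | h)
      · obtain ⟨f, hf, hfs⟩ := hs'.1 h
        exact ⟨f, hf, hfs.trans Set.subset_union_left⟩
      · obtain ⟨f, hf, hfs⟩ := ht'.1 h
        exact ⟨f, hf, hfs.trans Set.subset_union_right⟩
    · rw [Set.mem_union, not_or] at h
      obtain ⟨f, hf, hfs⟩ := hs'.2 h.1
      obtain ⟨g, hg, hgt⟩ := ht'.2 h.2
      refine ⟨f * g, mul_ne_zero hf hg, ?_⟩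
      rw [PrimeSpectrum.basicOpen_mul, Set.compl_union]
      exact Set.inter_subset_inter hfs hgt
  | compl s hs hs' =>
    -- Complementation exchanges the two halves, which is why the induction carries both.
    refine ⟨hs'.2, fun h => ?_⟩
    rw [compl_compl]
    exact hs'.1 (by simpa using h)

open MvPolynomial in
/-- If no nonzero polynomial vanishes on the image under a polynomial map `F` of the open set
`N ≠ 0`, then this image contains a nonempty open set. -/
theorem exists_open_subset_image {σ τ : Type*} [Finite σ] [Finite τ]
    (F : τ → MvPolynomial σ ℂ) (N : MvPolynomial σ ℂ)
    (h : ∀ f : MvPolynomial τ ℂ,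
      (∀ x, eval x N ≠ 0 → eval (fun t => eval x (F t)) f = 0) → f = 0) :
    ∃ f : MvPolynomial τ ℂ, f ≠ 0 ∧
      ∀ y, eval y f ≠ 0 → ∃ x, eval x N ≠ 0 ∧ ∀ t, eval x (F t) = y t := by
  set φ : MvPolynomial τ ℂ →ₐ[ℂ] MvPolynomial σ ℂ := aeval F with hφ
  have heval (x : σ → ℂ) (g : MvPolynomial τ ℂ) :
      eval x (φ g) = eval (fun t => eval x (F t)) g := by
    have := eval₂_comp_left (eval x) (C : ℂ →+* MvPolynomial σ ℂ) F g
    simp only [hφ, aeval_def, algebraMap_eq]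
    rw [this]
    simp only [eval, coe_eval₂Hom]
    congr 1
    ext; simp
  have hfp : φ.toRingHom.FinitePresentation := by
    have h1 : (algebraMap ℂ (MvPolynomial σ ℂ)).FinitePresentation :=
      RingHom.finitePresentation_algebraMap.2 inferInstance
    have h2 : (algebraMap ℂ (MvPolynomial τ ℂ)).FiniteType :=
      RingHom.finiteType_algebraMap.2 inferInstance
    refine RingHom.FinitePresentation.of_comp_finiteType (algebraMap ℂ (MvPolynomial τ ℂ)) ?_ h2
    have : φ.toRingHom.comp (algebraMap ℂ (MvPolynomial τ ℂ)) =
        algebraMap ℂ (MvPolynomial σ ℂ) := φ.comp_algebraMap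
    rw [this]; exact h1
  have hcon := PrimeSpectrum.isConstructible_comap_image hfp
    (PrimeSpectrum.isConstructible_basicOpen (f := N))
  have hbot : (⊥ : PrimeSpectrum (MvPolynomial τ ℂ)) ∈
      PrimeSpectrum.comap φ.toRingHom '' (PrimeSpectrum.basicOpen N : Set _) := by
    -- A prime avoiding N and the images of all nonzero polynomials lies in N ≠ 0 and contracts to
    -- the zero ideal. It exists because φ(g) N^k = 0 would make g vanish on the image, so that g =
    -- 0 by `h`.
    have hdisj : Disjoint ((⊥ : Ideal (MvPolynomial σ ℂ)) : Set (MvPolynomial σ ℂ))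
        (((nonZeroDivisors (MvPolynomial τ ℂ)).map φ.toRingHom ⊔ Submonoid.powers N :
          Submonoid (MvPolynomial σ ℂ)) : Set (MvPolynomial σ ℂ)) := by
      rw [Set.disjoint_left]
      intro z hz hz'
      obtain ⟨_, ⟨g, hg, rfl⟩, _, ⟨k, rfl⟩, hgk⟩ := Submonoid.mem_sup.1 hz'
      rw [Ideal.mem_bot.1 hz] at hgk
      refine nonZeroDivisors.ne_zero hg (h g fun x hx => ?_)
      have := congrArg (eval x) hgk
      rw [map_mul, map_pow, map_zero] at this
      rw [← heval]
      exact (mul_eq_zero.1 this).resolve_right (pow_ne_zero _ hx)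
    obtain ⟨q, hq, -, hqS⟩ := Ideal.exists_le_prime_disjoint _ _ hdisj
    rw [Set.disjoint_left] at hqS
    refine ⟨⟨q, hq⟩, fun hN => hqS hN (Submonoid.mem_sup_right ⟨1, pow_one N⟩), ?_⟩
    ext g
    simp only [PrimeSpectrum.comap_asIdeal, Ideal.mem_comap, PrimeSpectrum.asIdeal_bot,
      Ideal.mem_bot]
    refine ⟨fun hg => by_contra fun hg0 => hqS hg (Submonoid.mem_sup_left
      ⟨g, mem_nonZeroDivisors_of_ne_zero hg0, rfl⟩), fun hg => by simp [hg]⟩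
  obtain ⟨f, hf, hsub⟩ := (exists_basicOpen_subset_of_isConstructible hcon).1 hbot
  refine ⟨f, hf, fun y hy => ?_⟩
  have hy' : (pointToPoint (k := ℂ) y) ∈ (PrimeSpectrum.basicOpen f : Set _) := fun hmem => by
    rw [pointToPoint, mem_vanishingIdeal_singleton_iff] at hmem
    exact hy (by simpa [aeval_eq_eval] using hmem)
  obtain ⟨q, hqN, hq⟩ := hsub hy'
  -- Nullstellensatz: since N ∉ q, some complex zero of q has N ≠ 0, and it lies over y because q
  -- contracts to the maximal ideal of y.
  have hN : N ∉ vanishingIdeal ℂ (zeroLocus ℂ q.asIdeal) := by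
    rw [IsPrime.vanishingIdeal_zeroLocus]; exact hqN
  rw [mem_vanishingIdeal_iff] at hN
  push Not at hN
  obtain ⟨x, hx, hxN⟩ := hN
  refine ⟨x, by simpa [aeval_eq_eval] using hxN, fun t => ?_⟩
  have ht : (X t - C (y t) : MvPolynomial τ ℂ) ∈ (pointToPoint (k := ℂ) y).asIdeal := by
    rw [pointToPoint, mem_vanishingIdeal_singleton_iff]; simp
  rw [← hq, PrimeSpectrum.comap_asIdeal, Ideal.mem_comap] at ht
  have := hx _ ht
  have h2 : φ.toRingHom (X t - C (y t)) = F t - C (y t) := by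
    change φ (X t - C (y t)) = _
    simp [hφ]
  rw [h2] at this
  simpa [sub_eq_zero] using this

open MvPolynomial in
theorem contDiff_eval {σ : Type*} [Fintype σ] (P : MvPolynomial σ ℂ) :
    ContDiff ℂ 1 (fun x => eval x P) := by
  induction P using MvPolynomial.induction_on with
  | C a => simpa using contDiff_const
  | add p q hp hq => simpa using hp.add hq
  | mul_X p s hp => simpa using hp.mul (contDiff_apply ℂ ℂ s)

open MvPolynomial in
/-- A polynomial map that is a submersion at a point of the open set `N ≠ 0` maps this open set
onto a set that contains a nonempty open set. -/
theorem exists_open_subset_image_of_fderiv_surjective {σ τ : Type*} [Fintype σ] [Fintype τ]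
    (F : τ → MvPolynomial σ ℂ) (N : MvPolynomial σ ℂ) (x₀ : σ → ℂ) (hN : eval x₀ N ≠ 0)
    (hF : (fderiv ℂ (fun x t => eval x (F t)) x₀).range = ⊤) :
    ∃ f : MvPolynomial τ ℂ, f ≠ 0 ∧
      ∀ y, eval y f ≠ 0 → ∃ x, eval x N ≠ 0 ∧ ∀ t, eval x (F t) = y t := by
  refine exists_open_subset_image F N fun f hf => ?_
  have hd : HasStrictFDerivAt (fun x t => eval x (F t))
      (fderiv ℂ (fun x t => eval x (F t)) x₀) x₀ :=
    (contDiff_pi.2 fun t => contDiff_eval (F t)).contDiffAt.hasStrictFDerivAt one_ne_zero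
  -- A submersion is open in the classical topology, so f vanishes on a ball. In the sup norm this
  -- is a product of infinite sets, which forces f = 0.
  have hev : ∀ᶠ y in nhds (fun t => eval x₀ (F t)), eval y f = 0 := by
    rw [← hd.map_nhds_eq_of_surj hF, Filter.eventually_map]
    filter_upwards [(contDiff_eval N).continuous.continuousAt.eventually_ne hN] with x hx
    exact hf x hx
  obtain ⟨ε, hε, hball⟩ := Metric.eventually_nhds_iff_ball.1 hev
  refine MvPolynomial.funext_set (fun t => Metric.ball (eval x₀ (F t)) ε)
    (fun t => ?_) fun y hy => ?_
  · exact infinite_of_mem_nhds _ (Metric.ball_mem_nhds _ hε)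
  · rw [map_zero]
    exact hball y (by rwa [ball_pi _ hε])

end Chevalley

/-! ### Polynomial families of vectors and openness of linear independence. -/

section PolynomialMaps

/-- The algebra of polynomial functions on the affine space `ℂ ^ σ`. -/
noncomputable def polyFun (σ : Type*) : Subalgebra ℂ ((σ → ℂ) → ℂ) :=
  (MvPolynomial.aeval (R := ℂ) (fun (s : σ) (x : σ → ℂ) => x s)).range

variable {σ : Type*}

theorem mem_polyFun_iff {g : (σ → ℂ) → ℂ} :
    g ∈ polyFun σ ↔ ∃ P : MvPolynomial σ ℂ, ∀ x, MvPolynomial.eval x P = g x := by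
  have key (P : MvPolynomial σ ℂ) (x : σ → ℂ) :
      MvPolynomial.aeval (R := ℂ) (fun (s : σ) (x : σ → ℂ) => x s) P x =
        MvPolynomial.eval x P := by
    induction P using MvPolynomial.induction_on with
    | C a => simp
    | add p q hp hq => simp [hp, hq]
    | mul_X p s hp => simp [hp]
  constructor
  · rintro ⟨P, rfl⟩
    exact ⟨P, fun x => (key P x).symm⟩
  · rintro ⟨P, hP⟩
    exact ⟨P, funext fun x => (key P x).trans (hP x)⟩

theorem coord_mem_polyFun (s : σ) : (fun x : σ → ℂ => x s) ∈ polyFun σ :=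
  mem_polyFun_iff.2 ⟨MvPolynomial.X s, fun x => by simp⟩

theorem const_mem_polyFun (c : ℂ) : (fun _ : σ → ℂ => c) ∈ polyFun σ :=
  mem_polyFun_iff.2 ⟨MvPolynomial.C c, fun x => by simp⟩

/-- A map from an affine space to a vector space is polynomial if its composition with every linear
functional is a polynomial function. -/
def IsPolyMap {H : Type*} [AddCommGroup H] [Module ℂ H] (v : (σ → ℂ) → H) : Prop :=
  ∀ φ : Module.Dual ℂ H, (fun x => φ (v x)) ∈ polyFun σ

namespace IsPolyMap

variable {H H' H'' : Type*} [AddCommGroup H] [Module ℂ H] [AddCommGroup H'] [Module ℂ H']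
  [AddCommGroup H''] [Module ℂ H'']

theorem const (h : H) : IsPolyMap (fun _ : σ → ℂ => h) := fun φ => const_mem_polyFun (φ h)

theorem smul {g : (σ → ℂ) → ℂ} {v : (σ → ℂ) → H} (hg : g ∈ polyFun σ) (hv : IsPolyMap v) :
    IsPolyMap (fun x => g x • v x) := fun φ => by
  simp only [map_smul, smul_eq_mul]
  exact (polyFun σ).mul_mem hg (hv φ)

theorem sum {ι : Type*} {s : Finset ι} {v : ι → (σ → ℂ) → H} (hv : ∀ i ∈ s, IsPolyMap (v i)) :
    IsPolyMap (fun x => ∑ i ∈ s, v i x) := fun φ => by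
  have := (polyFun σ).sum_mem fun i hi => hv i hi φ
  convert this using 1
  ext x
  simp

theorem comp_linearMap {v : (σ → ℂ) → H} (hv : IsPolyMap v) (f : H →ₗ[ℂ] H') :
    IsPolyMap (fun x => f (v x)) := fun φ => hv (φ ∘ₗ f)

theorem pi {ι : Type*} [Fintype ι] {v : (σ → ℂ) → ι → H} (hv : ∀ i, IsPolyMap (fun x => v x i)) :
    IsPolyMap v := by
  classical
  have : v = fun x => ∑ i, LinearMap.single ℂ (fun _ : ι => H) i (v x i) := by
    ext x i
    simp
  rw [this]
  exact sum fun i _ => (hv i).comp_linearMap _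

theorem bilin [FiniteDimensional ℂ H] {u : (σ → ℂ) → H} {v : (σ → ℂ) → H'}
    (hu : IsPolyMap u) (hv : IsPolyMap v) (B : H →ₗ[ℂ] H' →ₗ[ℂ] H'') :
    IsPolyMap (fun x => B (u x) (v x)) := by
  let b := Module.finBasis ℂ H
  have : (fun x => B (u x) (v x)) = fun x => ∑ i, b.coord i (u x) • B (b i) (v x) := by
    ext x
    conv_lhs => rw [← b.sum_repr (u x)]
    simp only [map_sum, map_smul, LinearMap.sum_apply, LinearMap.smul_apply,
      Module.Basis.coord_apply]
  rw [this]
  exact sum fun i _ => (hv.comp_linearMap (B (b i))).smul (hu (b.coord i))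

/-- Linear independence is an open condition on polynomial families of vectors. -/
theorem exists_linearIndependent {ι : Type*} [Fintype ι] {v : ι → (σ → ℂ) → H}
    (hv : ∀ i, IsPolyMap (v i)) {x₀ : σ → ℂ} (h₀ : LinearIndependent ℂ (fun i => v i x₀)) :
    ∃ N : MvPolynomial σ ℂ, MvPolynomial.eval x₀ N ≠ 0 ∧
      ∀ x, MvPolynomial.eval x N ≠ 0 → LinearIndependent ℂ (fun i => v i x) := by
  classical
  -- With functionals φᵢ dual to the vectors at x₀, the polynomial N is det(φᵢ(vⱼ(x))): it is 1 at
  -- x₀, and independence holds wherever it is nonzero.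
  have hdual (i : ι) : ∃ φ : Module.Dual ℂ H, ∀ j, φ (v j x₀) = if j = i then 1 else 0 := by
    obtain ⟨g, hg⟩ := (h₀.repr).exists_extend
    refine ⟨(Finsupp.lapply i).comp g, fun j => ?_⟩
    have hj : v j x₀ ∈ Submodule.span ℂ (Set.range fun i => v i x₀) :=
      Submodule.subset_span ⟨j, rfl⟩
    have h1 : g (v j x₀) = h₀.repr ⟨v j x₀, hj⟩ := by rw [← LinearMap.coe_coe]; rw [← hg]; rfl
    rw [LinearMap.comp_apply, h1, h₀.repr_eq_single j ⟨v j x₀, hj⟩ rfl]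
    simp [Finsupp.single_apply]
  choose φ hφ using hdual
  have hdet : (fun x => (Matrix.of fun i j => φ i (v j x)).det) ∈ polyFun σ := by
    have := (polyFun σ).sum_mem (t := Finset.univ) (f := fun (p : Equiv.Perm ι) =>
      (((Equiv.Perm.sign p : ℤ) : ℂ)) • ∏ i, fun x => φ (p i) (v i x)) fun p _ =>
      (polyFun σ).smul_mem ((polyFun σ).prod_mem fun i _ => hv i (φ (p i))) _
    convert this using 1
    ext x
    simp [Matrix.det_apply, Units.smul_def]
  obtain ⟨N, hN⟩ := mem_polyFun_iff.1 hdet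
  refine ⟨N, ?_, fun x hx => ?_⟩
  · rw [hN]
    have : (Matrix.of fun i j => φ i (v j x₀)) = 1 := by
      ext i j
      simp [hφ, Matrix.one_apply, eq_comm]
    rw [this]
    simp
  · rw [hN] at hx
    rw [Fintype.linearIndependent_iff]
    intro g hg
    refine congrFun (Matrix.eq_zero_of_mulVec_eq_zero hx (v := g) ?_)
    ext i
    have := congrArg (φ i) hg
    simpa [Matrix.mulVec, dotProduct, mul_comm] using this

end IsPolyMap

end PolynomialMaps

/-! ### Uniqueness of the five-secant space as linear algebra. -/

section LinearAlgebra

/-- A hyperplane of a subspace is cut out by a linear functional. -/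
theorem exists_dual_cutting {E : Type*} [AddCommGroup E] [Module ℂ E] {n : ℕ}
    {W W' : Submodule ℂ E} (hle : W ≤ W') (hW : Module.finrank ℂ W = n)
    (hW' : Module.finrank ℂ W' = n + 1) :
    ∃ l : Module.Dual ℂ E, ∀ x ∈ W', x ∈ W ↔ l x = 0 := by
  have : FiniteDimensional ℂ W' := FiniteDimensional.of_finrank_pos (by omega)
  obtain ⟨u, hu, huW⟩ : ∃ u ∈ W', u ∉ W := by
    by_contra! h
    have : W = W' := le_antisymm hle h
    rw [this] at hW
    omega
  obtain ⟨l, hlu, hl⟩ := Submodule.exists_le_ker_of_notMem huW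
  refine ⟨l, fun x hx => ⟨fun h => hl h, fun h => ?_⟩⟩
  have h1 : W ≤ W' ⊓ LinearMap.ker l := le_inf hle hl
  have h2 : W' ⊓ LinearMap.ker l < W' := by
    refine lt_of_le_of_ne inf_le_left fun h => hlu ?_
    exact (h.ge hu).2
  have h3 := Submodule.finrank_lt_finrank_of_lt h2
  have : FiniteDimensional ℂ (W' ⊓ LinearMap.ker l : Submodule ℂ E) :=
    Submodule.finiteDimensional_inf_left _ _
  have h4 : W = W' ⊓ LinearMap.ker l := Submodule.eq_of_le_of_finrank_le h1 (by omega)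
  rw [h4]
  exact ⟨hx, h⟩

theorem eq_zero_of_forall_dual {E : Type*} [AddCommGroup E] [Module ℂ E] {x : E}
    (h : ∀ φ : Module.Dual ℂ E, φ x = 0) : x = 0 :=
  (Module.forall_dual_apply_eq_zero_iff ℂ x).1 h

variable {E F : Type*} [AddCommGroup E] [Module ℂ E] [AddCommGroup F] [Module ℂ F]

/-- The genericity conditions on a subspace, spanned by `w`, of the span of five vectors `ω`,
with respect to a symmetric bilinear map `m` for which the vectors `ω` are isotropic. -/
structure IsGeneric (m : E →ₗ[ℂ] E →ₗ[ℂ] F) (ω : Fin 5 → E) (w : Fin 4 → E) : Prop where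
  -- The diagonal of c stays free because the squares of the ωⱼ vanish in the application; the
  -- condition then says that the ten mixed products are independent.
  products : ∀ c : Fin 5 → Fin 5 → ℂ, (∀ j k, c j k = c k j) →
    ∑ j, ∑ k, c j k • m (ω j) (ω k) = 0 → ∀ j k, j ≠ k → c j k = 0
  indep : LinearIndependent ℂ ω
  indep_sub : LinearIndependent ℂ w
  mem : ∀ i, w i ∈ Submodule.span ℂ (Set.range ω)
  notMem : ∀ j, ω j ∉ Submodule.span ℂ (Set.range w)
  saturated : ∀ θ, (∀ i, m θ (w i) ∈
    Submodule.span ℂ (Set.range fun p : Fin 5 × Fin 5 => m (ω p.1) (ω p.2))) →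
    θ ∈ Submodule.span ℂ (Set.range ω)

namespace IsGeneric

variable {m : E →ₗ[ℂ] E →ₗ[ℂ] F} {ω : Fin 5 → E} {w : Fin 4 → E}

theorem le (h : IsGeneric m ω w) :
    Submodule.span ℂ (Set.range w) ≤ Submodule.span ℂ (Set.range ω) := by
  rw [Submodule.span_le]
  rintro _ ⟨i, rfl⟩
  exact h.mem i

theorem finrank_sub (h : IsGeneric m ω w) :
    Module.finrank ℂ (Submodule.span ℂ (Set.range w)) = 4 := by
  simpa using finrank_span_eq_card h.indep_sub

theorem finrank_span (h : IsGeneric m ω w) :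
    Module.finrank ℂ (Submodule.span ℂ (Set.range ω)) = 5 := by
  simpa using finrank_span_eq_card h.indep

/-- The products of elements of the small subspace span a space isomorphic to its symmetric
square. -/
theorem sum_dual_mul_dual (h : IsGeneric m ω w) {ι : Type*} [Fintype ι] (c : ι → ℂ) (x : ι → E)
    (hx : ∀ i, x i ∈ Submodule.span ℂ (Set.range w)) (h0 : ∑ i, c i • m (x i) (x i) = 0)
    (α β : Module.Dual ℂ E) : ∑ i, c i * (α (x i) * β (x i)) = 0 := by
  obtain ⟨l, hl⟩ := exists_dual_cutting h.le h.finrank_sub h.finrank_span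
  have hl0 (j : Fin 5) : l (ω j) ≠ 0 := fun h1 =>
    h.notMem j ((hl _ (Submodule.subset_span ⟨j, rfl⟩)).2 h1)
  have hX (i : ι) : ∃ X : Fin 5 → ℂ, ∑ j, X j • ω j = x i :=
    (Submodule.mem_span_range_iff_exists_fun ℂ).1 (h.le (hx i))
  choose X hX using hX
  have hlX (i : ι) : ∑ j, X i j * l (ω j) = 0 := by
    have := (hl _ (h.le (hx i))).1 (hx i)
    rw [← hX i] at this
    simpa using this
  -- These sums are the coordinates of the tensor ∑ cᵢ xᵢ ⊗ xᵢ in the vectors ω.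
  have hoff : ∀ j k, j ≠ k → ∑ i, c i * (X i j * X i k) = 0 := by
    refine h.products (fun j k => ∑ i, c i * (X i j * X i k))
      (fun j k => Finset.sum_congr rfl fun i _ => by ring) ?_
    rw [← h0]
    simp_rw [Finset.sum_smul]
    rw [Finset.sum_congr rfl fun j _ => Finset.sum_comm, Finset.sum_comm]
    refine Finset.sum_congr rfl fun i _ => ?_
    simp only [← hX i, map_sum, LinearMap.sum_apply, map_smul, LinearMap.smul_apply,
      Finset.smul_sum, smul_smul]
    rw [Finset.sum_comm]
    refine Finset.sum_congr rfl fun k _ => Finset.sum_congr rfl fun j _ => ?_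
    congr 1
    ring
  -- The tensor is now diagonal, and contracting it with l gives zero since l kills every xᵢ. As
  -- l(ωⱼ) ≠ 0, the diagonal entries vanish too.
  have hdiag (j : Fin 5) : ∑ i, c i * (X i j * X i j) = 0 := by
    have h1 : (∑ i, c i * (X i j * X i j)) * l (ω j) = 0 := by
      have h2 : ∑ k, (∑ i, c i * (X i j * X i k)) * l (ω k) = 0 := by
        simp_rw [Finset.sum_mul]
        rw [Finset.sum_comm]
        refine Finset.sum_eq_zero fun i _ => ?_
        have : ∑ k, c i * (X i j * X i k) * l (ω k) =
            c i * X i j * ∑ k, X i k * l (ω k) := by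
          rw [Finset.mul_sum]
          exact Finset.sum_congr rfl fun k _ => by ring
        rw [this, hlX, mul_zero]
      rw [← h2, Finset.sum_eq_single j]
      · intro k _ hk
        rw [hoff j k hk.symm, zero_mul]
      · simp
    exact (mul_eq_zero.1 h1).resolve_right (hl0 j)
  have hall (j k : Fin 5) : ∑ i, c i * (X i j * X i k) = 0 := by
    by_cases hjk : j = k
    · rw [hjk]; exact hdiag k
    · exact hoff j k hjk
  have : ∑ i, c i * (α (x i) * β (x i)) =
      ∑ j, ∑ k, (∑ i, c i * (X i j * X i k)) * (α (ω j) * β (ω k)) := by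
    simp_rw [Finset.sum_mul]
    rw [Finset.sum_congr rfl fun j _ => Finset.sum_comm, Finset.sum_comm]
    refine Finset.sum_congr rfl fun i _ => ?_
    simp only [← hX i, map_sum, map_smul, smul_eq_mul]
    rw [Finset.sum_mul_sum, Finset.mul_sum]
    refine Finset.sum_congr rfl fun j _ => ?_
    rw [Finset.mul_sum]
    exact Finset.sum_congr rfl fun k _ => by ring
  rw [this]
  exact Finset.sum_eq_zero fun j _ => Finset.sum_eq_zero fun k _ => by rw [hall, zero_mul]

theorem eq_zero_of_isotropic (h : IsGeneric m ω w) {x : E}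
    (hx : x ∈ Submodule.span ℂ (Set.range w)) (h0 : m x x = 0) : x = 0 := by
  refine eq_zero_of_forall_dual fun φ => ?_
  simpa using h.sum_dual_mul_dual (fun _ : Unit => 1) (fun _ => x) (fun _ => hx) (by simpa) φ φ

/-- Distinct nonzero solutions in the small subspace of an equation `y ^ 2 = f y`, where `f` is
linear, are linearly independent. -/
theorem linearIndependent_of_sq_eq (h : IsGeneric m ω w) (f : E →ₗ[ℂ] F) {ι : Type*} [Finite ι]
    {y : ι → E} (hy : ∀ i, y i ∈ Submodule.span ℂ (Set.range w)) (hinj : Function.Injective y)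
    (hy0 : ∀ i, y i ≠ 0) (hsq : ∀ i, m (y i) (y i) = f (y i)) : LinearIndependent ℂ y := by
  classical
  have := Fintype.ofFinite ι
  suffices H : ∀ s : Finset ι, LinearIndepOn ℂ y (s : Set ι) by
    rw [← linearIndepOn_univ_iff]
    simpa using H Finset.univ
  intro s
  induction s using Finset.induction_on with
  | empty => simp
  | insert a s ha ih =>
    rw [Finset.coe_insert, linearIndepOn_insert (by simpa using ha)]
    refine ⟨ih, fun hmem => ?_⟩
    rw [Submodule.mem_span_image_finset_iff_exists_fun] at hmem
    obtain ⟨t, ht⟩ := hmem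
    -- If y_a = ∑ tᵢyᵢ, linearity of f gives y_a² = ∑ tᵢyᵢ², hence y_a ⊗ y_a = ∑ tᵢ yᵢ ⊗ yᵢ.
    -- Contract with β and subtract β(y_a) times the first relation.
    have hkey (β : Module.Dual ℂ E) : ∑ i : s, (t i * (β (y i) - β (y a))) • y i = 0 := by
      refine eq_zero_of_forall_dual fun α => ?_
      have h1 := h.sum_dual_mul_dual (ι := Option s)
        (fun o => o.elim (-1) t) (fun o => o.elim (y a) fun i => y i)
        (by rintro (_ | i) <;> exact hy _) (by
          rw [Fintype.sum_option]
          simp only [Option.elim_none, Option.elim_some, hsq]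
          rw [← ht]
          simp) α β
      rw [Fintype.sum_option] at h1
      simp only [Option.elim_none, Option.elim_some] at h1
      have h2 : α (y a) = ∑ i : s, t i * α (y i) := by rw [← ht]; simp
      have h3 : ∑ i : s, t i * (β (y i) - β (y a)) * α (y i) =
          ∑ i : s, t i * (α (y i) * β (y i)) - (∑ i : s, t i * α (y i)) * β (y a) := by
        rw [Finset.sum_mul, ← Finset.sum_sub_distrib]
        exact Finset.sum_congr rfl fun i _ => by ring
      simp only [map_sum, map_smul, smul_eq_mul]
      rw [h3, ← h2]
      linear_combination h1
    have ht0 (i : s) : t i = 0 := by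
      by_contra hti
      have hia : y i - y a = 0 := by
        refine eq_zero_of_forall_dual fun β => ?_
        have := Fintype.linearIndependent_iff.1 ih _ (hkey β) i
        rw [map_sub]
        exact (mul_eq_zero.1 this).resolve_left hti
      exact ha (hinj (sub_eq_zero.1 hia) ▸ i.2)
    refine hy0 a ?_
    rw [← ht]
    exact Finset.sum_eq_zero fun i _ => by rw [ht0 i, zero_smul]

theorem mul_mem (h : IsGeneric m ω w) {x y : E} (hx : x ∈ Submodule.span ℂ (Set.range w))
    (hy : y ∈ Submodule.span ℂ (Set.range w)) :
    m x y ∈ Submodule.span ℂ (Set.range fun p : Fin 5 × Fin 5 => m (ω p.1) (ω p.2)) := by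
  obtain ⟨X, rfl⟩ := (Submodule.mem_span_range_iff_exists_fun ℂ).1 (h.le hx)
  obtain ⟨Y, rfl⟩ := (Submodule.mem_span_range_iff_exists_fun ℂ).1 (h.le hy)
  simp only [map_sum, LinearMap.sum_apply, map_smul, LinearMap.smul_apply]
  exact Submodule.sum_mem _ fun j _ => Submodule.smul_mem _ _ <| Submodule.sum_mem _ fun k _ =>
    Submodule.smul_mem _ _ <| Submodule.subset_span ⟨(_, _), rfl⟩

/-- The span of `ω` is the only five-dimensional space that contains the span of `w` and five
pairwise non-proportional isotropic vectors. -/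
theorem eq_span_of_five (h : IsGeneric m ω w) (hm : ∀ x y, m x y = m y x) {W : Submodule ℂ E}
    (hle : Submodule.span ℂ (Set.range w) ≤ W) (hW : Module.finrank ℂ W = 5) (u : Fin 5 → E)
    (hu : ∀ j, u j ∈ W) (hu0 : ∀ j, u j ≠ 0) (hsq : ∀ j, m (u j) (u j) = 0)
    (hne : ∀ j k, j ≠ k → ∀ c : ℂ, u j ≠ c • u k) : W = Submodule.span ℂ (Set.range ω) := by
  obtain ⟨l, hl⟩ := exists_dual_cutting hle h.finrank_sub hW
  -- The span of w has no nonzero isotropic vector, so every uⱼ can be scaled to l = 1.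
  have hlu (j : Fin 5) : l (u j) ≠ 0 := fun h0 =>
    hu0 j (h.eq_zero_of_isotropic ((hl _ (hu j)).2 h0) (hsq j))
  set v : Fin 5 → E := fun j => (l (u j))⁻¹ • u j with hv
  have hlv (j : Fin 5) : l (v j) = 1 := by simp [hv, hlu j]
  have hvW (j : Fin 5) : v j ∈ W := W.smul_mem _ (hu j)
  have hvsq (j : Fin 5) : m (v j) (v j) = 0 := by simp [hv, hsq]
  have hvinj : Function.Injective v := by
    intro j k hjk
    by_contra hne'
    refine hne j k hne' (l (u j) * (l (u k))⁻¹) ?_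
    rw [mul_smul]
    change _ = l (u j) • v k
    rw [← hjk]
    simp [hv, smul_smul, hlu j]
  set y : Fin 4 → E := fun i => v i.succ - v 0 with hy
  have hyw (i : Fin 4) : y i ∈ Submodule.span ℂ (Set.range w) :=
    (hl _ (W.sub_mem (hvW _) (hvW _))).2 (by simp [hlv])
  -- Both sides are -2v₀vᵢ₊₁, because the v's have square zero.
  have hysq (i : Fin 4) : m (y i) (y i) = ((-2 : ℂ) • m (v 0)) (y i) := by
    simp only [hy, map_sub, LinearMap.sub_apply, hvsq, hm (v i.succ) (v 0), LinearMap.smul_apply]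
    module
  have hyind : LinearIndependent ℂ y := h.linearIndependent_of_sq_eq ((-2 : ℂ) • m (v 0)) hyw
    (fun i j hij => Fin.succ_injective _ (hvinj (sub_left_injective hij)))
    (fun i h0 => Fin.succ_ne_zero i (hvinj (sub_eq_zero.1 h0))) hysq
  have hspan : Submodule.span ℂ (Set.range y) = Submodule.span ℂ (Set.range w) := by
    have : FiniteDimensional ℂ (Submodule.span ℂ (Set.range w)) :=
      FiniteDimensional.span_of_finite ℂ (Set.finite_range w)
    refine Submodule.eq_of_le_of_finrank_eq ?_ ?_
    · rw [Submodule.span_le]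
      rintro _ ⟨i, rfl⟩
      exact hyw i
    · rw [h.finrank_sub]
      simpa using finrank_span_eq_card hyind
  -- Each wᵢ is a combination of the y's, so v₀wᵢ is a combination of the squares yₖ², to which
  -- `saturated` applies.
  have hv0 : v 0 ∈ Submodule.span ℂ (Set.range ω) := by
    refine h.saturated _ fun i => ?_
    have hi : w i ∈ Submodule.span ℂ (Set.range y) :=
      hspan ▸ Submodule.subset_span ⟨i, rfl⟩
    obtain ⟨Y, hY⟩ := (Submodule.mem_span_range_iff_exists_fun ℂ).1 hi
    rw [← hY, map_sum]
    refine Submodule.sum_mem _ fun k _ => ?_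
    rw [map_smul]
    refine Submodule.smul_mem _ _ ?_
    have : m (v 0) (y k) = (-2 : ℂ)⁻¹ • m (y k) (y k) := by
      rw [hysq, LinearMap.smul_apply, smul_smul]
      norm_num
    rw [this]
    exact Submodule.smul_mem _ _ (h.mul_mem (hyw k) (hyw k))
  have : FiniteDimensional ℂ (Submodule.span ℂ (Set.range ω)) :=
    FiniteDimensional.span_of_finite ℂ (Set.finite_range ω)
  refine Submodule.eq_of_le_of_finrank_eq (fun x hx => ?_) (hW.trans h.finrank_span.symm)
  have h1 : x - l x • v 0 ∈ Submodule.span ℂ (Set.range w) :=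
    (hl _ (W.sub_mem hx (W.smul_mem _ (hvW 0)))).2 (by simp [hlv])
  have := Submodule.add_mem _ (h.le h1) (Submodule.smul_mem _ (l x) hv0)
  simpa using this

/-- An isotropic vector in the span of `ω` is proportional to one of the `ω j`. -/
theorem exists_eq_smul_of_isotropic (h : IsGeneric m ω w) {x : E}
    (hx : x ∈ Submodule.span ℂ (Set.range ω)) (h0 : m x x = 0) : ∃ j, ∃ c : ℂ, x = c • ω j := by
  obtain ⟨X, rfl⟩ := (Submodule.mem_span_range_iff_exists_fun ℂ).1 hx
  have hX := h.products (fun j k => X j * X k) (fun j k => mul_comm _ _) (by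
    rw [← h0]
    simp only [map_sum, LinearMap.sum_apply, map_smul, LinearMap.smul_apply, Finset.smul_sum,
      smul_smul]
    rw [Finset.sum_comm]
    simp_rw [mul_comm])
  by_cases hall : ∀ j, X j = 0
  · exact ⟨0, 0, by simp [hall]⟩
  · push Not at hall
    obtain ⟨j, hj⟩ := hall
    refine ⟨j, X j, Finset.sum_eq_single j (fun k _ hk => ?_) (by simp)⟩
    rw [(mul_eq_zero.1 (hX j k hk.symm)).resolve_left hj, zero_smul]

end IsGeneric

end LinearAlgebra

/-! ### Passage to projective points and fibres of the projection. -/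

section Projective

variable {E : Type*} [AddCommGroup E] [Module ℂ E]

theorem mem_projOf_iff {W : Submodule ℂ E} {x : ℙ ℂ E} : x ∈ projOf W ↔ x.rep ∈ W := by
  change x.submodule ≤ W ↔ _
  rw [Projectivization.submodule_eq, Submodule.span_singleton_le_iff_mem]

theorem mk_mem_projOf_iff {W : Submodule ℂ E} {v : E} (hv : v ≠ 0) :
    Projectivization.mk ℂ v hv ∈ projOf W ↔ v ∈ W := by
  change (Projectivization.mk ℂ v hv).submodule ≤ W ↔ _
  rw [Projectivization.submodule_mk, Submodule.span_singleton_le_iff_mem]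

theorem finrank_sup_span_singleton {W : Submodule ℂ E} {n : ℕ} [FiniteDimensional ℂ W]
    (hW : Module.finrank ℂ W = n) {v : E} (hv : v ∉ W) :
    Module.finrank ℂ (W ⊔ Submodule.span ℂ {v} : Submodule ℂ E) = n + 1 := by
  have hv0 : v ≠ 0 := fun h => hv (h ▸ W.zero_mem)
  have h1 := Submodule.finrank_sup_add_finrank_inf_eq W (Submodule.span ℂ {v})
  have h2 : W ⊓ Submodule.span ℂ {v} = ⊥ :=
    disjoint_iff.1 ((Submodule.disjoint_span_singleton' hv0).2 hv)
  rw [h2, finrank_bot, finrank_span_singleton hv0] at h1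
  omega

/-- The fibre of the projection from `W` over the class of `v` consists of the points of the span
of `W` and `v` that are not in `W`. -/
theorem projectFrom_eq_iff {W : Submodule ℂ E} {v : E} (hv : W.mkQ v ≠ 0)
    (x : {x : ℙ ℂ E // x ∉ projOf W}) :
    projectFrom W x = Projectivization.mk ℂ (W.mkQ v) hv ↔
      x.1 ∈ projOf (W ⊔ Submodule.span ℂ {v}) := by
  have hx : W.mkQ x.1.rep ≠ 0 := fun h => x.2 (mem_projOf_iff.2 (by simpa using h))
  rw [mem_projOf_iff, Submodule.mem_sup]
  change Projectivization.mk ℂ (W.mkQ x.1.rep) hx = _ ↔ _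
  rw [Projectivization.mk_eq_mk_iff']
  constructor
  · rintro ⟨c, hc⟩
    rw [← map_smul, ← sub_eq_zero, ← map_sub] at hc
    refine ⟨x.1.rep - c • v, ?_, c • v, Submodule.mem_span_singleton.2 ⟨c, rfl⟩, by simp⟩
    have : c • v - x.1.rep ∈ W := (Submodule.Quotient.mk_eq_zero W).1 hc
    simpa using W.neg_mem this
  · rintro ⟨a, ha, _, hb, hab⟩
    obtain ⟨c, rfl⟩ := Submodule.mem_span_singleton.1 hb
    refine ⟨c, ?_⟩
    have : W.mkQ a = 0 := by simpa using ha
    rw [← hab, map_add, this, zero_add, map_smul]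

theorem encard_fibre {W : Submodule ℂ E} {v : E} (hv : W.mkQ v ≠ 0) {G : Set (ℙ ℂ E)}
    (hG : Disjoint (projOf W) G) :
    {x : {x : ℙ ℂ E // x ∉ projOf W} |
      x.1 ∈ G ∧ projectFrom W x = Projectivization.mk ℂ (W.mkQ v) hv}.encard =
      (projOf (W ⊔ Submodule.span ℂ {v}) ∩ G).encard := by
  rw [← Subtype.val_injective.encard_image]
  congr 1
  ext x
  constructor
  · rintro ⟨x, ⟨hxG, hx⟩, rfl⟩
    exact ⟨(projectFrom_eq_iff hv x).1 hx, hxG⟩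
  · rintro ⟨hx, hxG⟩
    have hxW : x ∉ projOf W := fun h => Set.disjoint_left.1 hG h hxG
    exact ⟨⟨x, hxW⟩, ⟨hxG, (projectFrom_eq_iff hv ⟨x, hxW⟩).2 hx⟩, rfl⟩

variable {F : Type*} [AddCommGroup F] [Module ℂ F]

namespace IsGeneric

variable {m : E →ₗ[ℂ] E →ₗ[ℂ] F} {ω : Fin 5 → E} {w : Fin 4 → E} {G : Set (ℙ ℂ E)}

/-- The projective points represented by `ω`. -/
noncomputable def point (h : IsGeneric m ω w) (j : Fin 5) : ℙ ℂ E :=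
  Projectivization.mk ℂ (ω j) (h.indep.ne_zero j)

theorem independent_point (h : IsGeneric m ω w) : Projectivization.Independent h.point :=
  Projectivization.Independent.mk ω h.indep.ne_zero h.indep

theorem injective_point (h : IsGeneric m ω w) : Function.Injective h.point := by
  intro j k hjk
  obtain ⟨c, hc⟩ := (Projectivization.mk_eq_mk_iff' ℂ _ _ _ _).1 hjk
  by_contra hne
  exact h.indep.notMem_span_image (s := {k}) (x := j) (by simpa using hne)
    (by simpa using Submodule.mem_span_singleton.2 ⟨c, hc⟩)

theorem projOf_inter (h : IsGeneric m ω w) (hG : ∀ x ∈ G, m x.rep x.rep = 0)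
    (hω : ∀ j, h.point j ∈ G) :
    projOf (Submodule.span ℂ (Set.range ω)) ∩ G = Set.range h.point := by
  ext x
  constructor
  · rintro ⟨hx, hxG⟩
    obtain ⟨j, c, hc⟩ := h.exists_eq_smul_of_isotropic (mem_projOf_iff.1 hx) (hG x hxG)
    refine ⟨j, ?_⟩
    rw [← x.mk_rep]
    refine ((Projectivization.mk_eq_mk_iff' ℂ _ _ _ _).2 ⟨c, hc.symm⟩).symm
  · rintro ⟨j, rfl⟩
    exact ⟨(mk_mem_projOf_iff _).2 (Submodule.subset_span ⟨j, rfl⟩), hω j⟩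

theorem disjoint (h : IsGeneric m ω w) (hG : ∀ x ∈ G, m x.rep x.rep = 0) :
    Disjoint (projOf (Submodule.span ℂ (Set.range w))) G :=
  Set.disjoint_left.2 fun x hx hxG =>
    x.rep_nonzero (h.eq_zero_of_isotropic (mem_projOf_iff.1 hx) (hG x hxG))

/-- Independence of the five points is not assumed, so this serves both five-secant spaces and
fibres, where the points are only known to be distinct. -/
theorem eq_span_of_injective (h : IsGeneric m ω w) (hm : ∀ x y, m x y = m y x)
    (hG : ∀ x ∈ G, m x.rep x.rep = 0) {W : Submodule ℂ E}
    (hle : Submodule.span ℂ (Set.range w) ≤ W) (hW : Module.finrank ℂ W = 5)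
    (u : Fin 5 → ℙ ℂ E) (hu : Function.Injective u) (huG : ∀ j, u j ∈ projOf W ∩ G) :
    W = Submodule.span ℂ (Set.range ω) := by
  refine h.eq_span_of_five hm hle hW (fun j => (u j).rep)
    (fun j => mem_projOf_iff.1 (huG j).1) (fun j => (u j).rep_nonzero)
    (fun j => hG _ (huG j).2) fun j k hjk c hc => hjk (hu ?_)
  rw [← (u j).mk_rep, ← (u k).mk_rep]
  exact (Projectivization.mk_eq_mk_iff' ℂ _ _ _ _).2 ⟨c, hc.symm⟩

theorem existsUnique_fiveSecant (h : IsGeneric m ω w) (hm : ∀ x y, m x y = m y x)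
    (hG : ∀ x ∈ G, m x.rep x.rep = 0) (hω : ∀ j, h.point j ∈ G) :
    ∃! W : Gr 5 E, Submodule.span ℂ (Set.range w) ≤ W.1 ∧
      ∃ u : Fin 5 → ℙ ℂ E, Projectivization.Independent u ∧ projOf W.1 ∩ G = Set.range u := by
  refine ⟨⟨Submodule.span ℂ (Set.range ω), h.finrank_span⟩,
    ⟨h.le, h.point, h.independent_point, h.projOf_inter hG hω⟩, ?_⟩
  rintro ⟨W, hW⟩ ⟨hle, u, hu, hWu⟩
  refine Subtype.ext (h.eq_span_of_injective hm hG hle hW u (fun j k hjk => ?_) fun j => ?_)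
  · exact (Projectivization.independent_iff.1 hu).injective
      (congrArg Projectivization.rep hjk)
  · exact hWu.ge ⟨j, rfl⟩

theorem existsUnique_fibre (h : IsGeneric m ω w) (hm : ∀ x y, m x y = m y x)
    (hG : ∀ x ∈ G, m x.rep x.rep = 0) (hω : ∀ j, h.point j ∈ G) :
    ∃! y : ℙ ℂ (E ⧸ Submodule.span ℂ (Set.range w)),
      {x : {x : ℙ ℂ E // x ∉ projOf (Submodule.span ℂ (Set.range w))} |
        x.1 ∈ G ∧ projectFrom _ x = y}.encard = 5 := by
  have hfin : FiniteDimensional ℂ (Submodule.span ℂ (Set.range w)) :=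
    FiniteDimensional.span_of_finite ℂ (Set.finite_range w)
  have hmk {v : E} (hv : v ∉ Submodule.span ℂ (Set.range w)) :
      (Submodule.span ℂ (Set.range w)).mkQ v ≠ 0 := by simpa using hv
  -- All ωⱼ have the same image under the projection, so the class of ω₀ is the required point.
  have hspan : Submodule.span ℂ (Set.range w) ⊔ Submodule.span ℂ {ω 0} =
      Submodule.span ℂ (Set.range ω) := by
    have : FiniteDimensional ℂ (Submodule.span ℂ (Set.range ω)) :=
      FiniteDimensional.span_of_finite ℂ (Set.finite_range ω)
    refine Submodule.eq_of_le_of_finrank_eq (sup_le h.le ?_) ?_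
    · rw [Submodule.span_singleton_le_iff_mem]
      exact Submodule.subset_span ⟨0, rfl⟩
    · rw [h.finrank_span, finrank_sup_span_singleton h.finrank_sub (h.notMem 0)]
  refine ⟨Projectivization.mk ℂ _ (hmk (h.notMem 0)), ?_, ?_⟩
  · change Set.encard _ = _
    rw [encard_fibre _ (h.disjoint hG), hspan, h.projOf_inter hG hω, ← Set.image_univ,
      h.injective_point.encard_image]
    simp
  · intro y hy
    induction y using Projectivization.ind with
    | h v hv =>
      obtain ⟨v, rfl⟩ := Submodule.mkQ_surjective _ v
      have hvw : v ∉ Submodule.span ℂ (Set.range w) := by simpa using hv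
      change Set.encard _ = _ at hy
      rw [encard_fibre _ (h.disjoint hG)] at hy
      set S := projOf (Submodule.span ℂ (Set.range w) ⊔ Submodule.span ℂ {v}) ∩ G with hS
      have : Finite S := Set.finite_of_encard_eq_coe (k := 5) (by simpa using hy)
      let e : S ≃ Fin 5 := Finite.equivFinOfCardEq (by
        rw [Nat.card_coe_set_eq, Set.ncard, hy]; rfl)
      have heq := h.eq_span_of_injective hm hG le_sup_left
        (finrank_sup_span_singleton h.finrank_sub hvw) (fun j => (e.symm j).1)
        (Subtype.val_injective.comp e.symm.injective) (fun j => (e.symm j).2)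
      have hvmem : v ∈ Submodule.span ℂ (Set.range w) ⊔ Submodule.span ℂ {ω 0} := by
        rw [hspan, ← heq]
        exact Submodule.mem_sup_right (Submodule.mem_span_singleton_self v)
      obtain ⟨a, ha, _, hb, hab⟩ := Submodule.mem_sup.1 hvmem
      obtain ⟨c, rfl⟩ := Submodule.mem_span_singleton.1 hb
      refine (Projectivization.mk_eq_mk_iff' ℂ _ _ _ _).2 ⟨c, ?_⟩
      have : (Submodule.span ℂ (Set.range w)).mkQ a = 0 := by simpa using ha
      rw [← hab, map_add, this, zero_add, map_smul]

end IsGeneric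

end Projective

/-! ### Zariski open subsets of the Grassmannian from polynomials on frames. -/

section Openness

/-- A property of subspaces is general if it holds for the spans of all tuples outside the zero
locus of a polynomial that is not identically zero. -/
theorem forGeneral_of_eval_ne_zero {E : Type*} [AddCommGroup E] [Module ℂ E] {k : ℕ} {τ : Type*}
    (c : (Fin k → E) →ₗ[ℂ] (τ → ℂ)) (f : MvPolynomial τ ℂ) {P : Gr k E → Prop}
    (hind : ∀ w, MvPolynomial.eval (c w) f ≠ 0 → LinearIndependent ℂ w)
    (hP : ∀ w (hw : MvPolynomial.eval (c w) f ≠ 0), P (frameSpan k E ⟨w, hind w hw⟩))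
    (hne : ∃ w, MvPolynomial.eval (c w) f ≠ 0) : ForGeneral k E P := by
  let act (g : Fin k → Fin k → ℂ) : (Fin k → E) →ₗ[ℂ] (Fin k → E) :=
    LinearMap.pi fun i => ∑ j, g i j • LinearMap.proj j
  have hact (g : Fin k → Fin k → ℂ) (w : Fin k → E) (i : Fin k) :
      act g w i = ∑ j, g i j • w j := by simp [act]
  -- The locus f ≠ 0 depends on the frame; O makes it depend on the span only. Singular matrices g
  -- do no harm: f ≠ 0 makes `act g w` independent, so it has the same span as the frame w.
  let O : Set (Fin k → E) := ⋃ g : Fin k → Fin k → ℂ, {w | MvPolynomial.eval (c (act g w)) f ≠ 0}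
  have hO : (zariskiTopology (Fin k → E)).IsOpen O := by
    let _ := zariskiTopology (Fin k → E)
    change IsOpen O
    refine isOpen_iUnion fun g => TopologicalSpace.isOpen_generateFrom_of_mem
      ⟨MvPolynomial.rename (fun t => LinearMap.proj t ∘ₗ c ∘ₗ act g) f, ?_⟩
    ext w
    simp only [Set.mem_ofPred_eq, MvPolynomial.eval_rename]
    rfl
  refine ⟨{W | ∃ w, ∃ hw : MvPolynomial.eval (c w) f ≠ 0, frameSpan k E ⟨w, hind w hw⟩ = W},
    ?_, ?_, ?_⟩
  · refine ⟨O, hO, ?_⟩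
    ext ⟨w, hw⟩
    constructor
    · intro hwO
      obtain ⟨g, hg⟩ := Set.mem_iUnion.1 hwO
      refine ⟨act g w, hg, Subtype.ext ?_⟩
      have : FiniteDimensional ℂ (Submodule.span ℂ (Set.range w)) :=
        FiniteDimensional.span_of_finite ℂ (Set.finite_range w)
      change Submodule.span ℂ (Set.range (act g w)) = Submodule.span ℂ (Set.range w)
      refine Submodule.eq_of_le_of_finrank_eq ?_ ?_
      · refine Submodule.span_le.2 ?_
        rintro _ ⟨i, rfl⟩
        rw [hact]
        exact Submodule.sum_mem _ fun j _ =>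
          Submodule.smul_mem _ _ (Submodule.subset_span ⟨j, rfl⟩)
      · exact (frameSpan k E ⟨_, hind _ hg⟩).2.trans (frameSpan k E ⟨w, hw⟩).2.symm
    · rintro ⟨w', hw', heq⟩
      have hmem (i : Fin k) : w' i ∈ Submodule.span ℂ (Set.range w) := by
        have := congrArg Subtype.val heq
        change Submodule.span ℂ (Set.range w') = Submodule.span ℂ (Set.range w) at this
        rw [← this]
        exact Submodule.subset_span ⟨i, rfl⟩
      choose g hg using fun i => (Submodule.mem_span_range_iff_exists_fun ℂ).1 (hmem i)
      refine Set.mem_iUnion.2 ⟨g, ?_⟩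
      have : act g w = w' := funext fun i => (hact g w i).trans (hg i)
      change MvPolynomial.eval (c (act g w)) f ≠ 0
      rwa [this]
  · obtain ⟨w, hw⟩ := hne
    exact ⟨_, w, hw, rfl⟩
  · rintro _ ⟨w, hw, rfl⟩
    exact hP w hw

end Openness

/-! ### Bivectors, Plücker coordinates and their symmetric product. -/

section Bivectors

variable {V : Type*} [AddCommGroup V] [Module ℂ V]

theorem update_pair_zero {α : Type*} (v w z : α) : Function.update ![v, w] 0 z = ![z, w] := by
  ext i; fin_cases i <;> rfl

theorem update_pair_one {α : Type*} (v w z : α) : Function.update ![v, w] 1 z = ![v, z] := by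
  ext i; fin_cases i <;> rfl

/-- The exterior product of two vectors, as a bilinear map. -/
noncomputable def wedge : V →ₗ[ℂ] V →ₗ[ℂ] ⋀[ℂ]^2 V :=
  LinearMap.mk₂ ℂ (fun v w => exteriorPower.ιMulti ℂ 2 ![v, w])
    (fun v v' w => by
      have := (exteriorPower.ιMulti ℂ 2 (M := V)).map_update_add ![v, w] 0 v v'
      rwa [update_pair_zero, update_pair_zero, update_pair_zero] at this)
    (fun c v w => by
      have := (exteriorPower.ιMulti ℂ 2 (M := V)).map_update_smul ![v, w] 0 c v
      rwa [update_pair_zero, update_pair_zero] at this)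
    (fun v w w' => by
      have := (exteriorPower.ιMulti ℂ 2 (M := V)).map_update_add ![v, w] 1 w w'
      rwa [update_pair_one, update_pair_one, update_pair_one] at this)
    (fun c v w => by
      have := (exteriorPower.ιMulti ℂ 2 (M := V)).map_update_smul ![v, w] 1 c w
      rwa [update_pair_one, update_pair_one] at this)

theorem wedge_apply (v w : V) : wedge v w = exteriorPower.ιMulti ℂ 2 ![v, w] := rfl

theorem wedge_self (v : V) : wedge v v = 0 :=
  (exteriorPower.ιMulti ℂ 2 (M := V)).map_eq_zero_of_eq ![v, v] (i := 0) (j := 1) rfl (by decide)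

theorem wedge_swap (v w : V) : wedge v w = -wedge w v := by
  have := wedge_self (v + w)
  simp only [map_add, LinearMap.add_apply, wedge_self, zero_add, add_zero] at this
  exact eq_neg_of_add_eq_zero_right this

variable (b : Module.Basis (Fin 6) ℂ V)

/-- The Plücker coordinates of a bivector. -/
noncomputable def plucker (i j : Fin 6) : Module.Dual ℂ (⋀[ℂ]^2 V) :=
  exteriorPower.pairingDual ℂ V 2 (exteriorPower.ιMulti ℂ 2 ![b.coord i, b.coord j])

theorem plucker_wedge (i j : Fin 6) (v w : V) :
    plucker b i j (wedge v w) = b.coord i v * b.coord j w - b.coord j v * b.coord i w := by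
  rw [wedge_apply, plucker, exteriorPower.pairingDual_ιMulti_ιMulti, Matrix.det_fin_two]
  simp

theorem plucker_wedge_basis (i j k l : Fin 6) :
    plucker b i j (wedge (b k) (b l)) =
      (if k = i then 1 else 0) * (if l = j then 1 else 0) -
        (if k = j then 1 else 0) * (if l = i then 1 else 0) := by
  simp [plucker_wedge, Finsupp.single_apply]

theorem dual_eq_zero_of_wedge_basis {κ : Module.Dual ℂ (⋀[ℂ]^2 V)}
    (h : ∀ k l, κ (wedge (b k) (b l)) = 0) : κ = 0 := by
  have h2 : (wedge (V := V)).compr₂ κ = 0 := b.ext fun k => b.ext fun l => by simpa using h k l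
  refine exteriorPower.linearMap_ext ?_
  ext v
  have : v = ![v 0, v 1] := by ext i; fin_cases i <;> rfl
  rw [this]
  exact LinearMap.congr_fun (LinearMap.congr_fun h2 (v 0)) (v 1)

/-- The exterior product of two bivectors in coordinates. -/
noncomputable def bivectorMul :
    ⋀[ℂ]^2 V →ₗ[ℂ] ⋀[ℂ]^2 V →ₗ[ℂ] (Fin 6 × Fin 6 × Fin 6 × Fin 6 → ℂ) :=
  LinearMap.mk₂ ℂ (fun x y q =>
      plucker b q.1 q.2.1 x * plucker b q.2.2.1 q.2.2.2 y
      + plucker b q.2.2.1 q.2.2.2 x * plucker b q.1 q.2.1 y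
      - plucker b q.1 q.2.2.1 x * plucker b q.2.1 q.2.2.2 y
      - plucker b q.2.1 q.2.2.2 x * plucker b q.1 q.2.2.1 y
      + plucker b q.1 q.2.2.2 x * plucker b q.2.1 q.2.2.1 y
      + plucker b q.2.1 q.2.2.1 x * plucker b q.1 q.2.2.2 y)
    (fun x x' y => by ext q; simp only [map_add, Pi.add_apply]; ring)
    (fun c x y => by ext q; simp only [map_smul, Pi.smul_apply, smul_eq_mul]; ring)
    (fun x y y' => by ext q; simp only [map_add, Pi.add_apply]; ring)
    (fun c x y => by ext q; simp only [map_smul, Pi.smul_apply, smul_eq_mul]; ring)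

theorem bivectorMul_apply (x y : ⋀[ℂ]^2 V) (i j k l : Fin 6) :
    bivectorMul b x y (i, j, k, l) =
      plucker b i j x * plucker b k l y + plucker b k l x * plucker b i j y
      - plucker b i k x * plucker b j l y - plucker b j l x * plucker b i k y
      + plucker b i l x * plucker b j k y + plucker b j k x * plucker b i l y := rfl

theorem bivectorMul_comm (x y : ⋀[ℂ]^2 V) : bivectorMul b x y = bivectorMul b y x := by
  ext ⟨i, j, k, l⟩
  simp only [bivectorMul_apply]
  ring

/-- These are the Plücker relations. Only this implication is needed; the converse, that they
characterise decomposable bivectors, plays no role. -/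
theorem bivectorMul_wedge_self (v w : V) : bivectorMul b (wedge v w) (wedge v w) = 0 := by
  ext ⟨i, j, k, l⟩
  simp only [bivectorMul_apply, plucker_wedge, Pi.zero_apply]
  ring

theorem bivectorMul_rep_of_mem_pluckerGr {x : ℙ ℂ (⋀[ℂ]^2 V)} (hx : x ∈ pluckerGr V) :
    bivectorMul b x.rep x.rep = 0 := by
  obtain ⟨v, w, h⟩ := hx
  have hmem : x.rep ∈ x.submodule := by
    rw [Projectivization.submodule_eq]
    exact Submodule.mem_span_singleton_self _
  rw [h] at hmem
  obtain ⟨c, hc⟩ := Submodule.mem_span_singleton.1 hmem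
  rw [← hc, ← wedge_apply]
  simp [bivectorMul_wedge_self]

theorem mk_wedge_mem_pluckerGr (v w : V) (h : wedge v w ≠ 0) :
    Projectivization.mk ℂ (wedge v w) h ∈ pluckerGr V :=
  ⟨v, w, by rw [Projectivization.submodule_mk, wedge_apply]⟩

end Bivectors

/-! ### The linear system behind the submersion. -/

section SpecialPoint

/-- The linear conditions on four alternating forms that annihilate the tangent space, at the chosen
configuration, of the family of configurations have only the trivial solution. -/
theorem eq_zero_of_annihilates_tangent {K : Fin 4 → Fin 6 → Fin 6 → ℂ}
    (hs : ∀ i k l, K i k l = -K i l k)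
    (h01 : ∀ i, K i 0 1 = 0) (h23 : ∀ i, K i 2 3 = 0) (h45 : ∀ i, K i 4 5 = 0)
    (h134 : ∀ i, K i 1 4 + K i 3 1 + K i 3 4 = 0)
    (h025 : ∀ i, K i 0 2 + K i 0 5 + K i 2 5 = 0)
    (h00 : ∀ k, K 0 0 k = 0) (h1 : ∀ k, K 0 1 k = 0)
    (h2 : ∀ k, K 1 2 k = 0) (h3 : ∀ k, K 1 3 k = 0)
    (h4 : ∀ k, K 2 4 k = 0) (h5 : ∀ k, K 2 5 k = 0)
    (h13 : ∀ k, K 3 1 k + K 3 3 k = 0) (h14 : ∀ k, K 3 1 k + K 3 4 k = 0)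
    (h02 : ∀ k, K 0 0 k + K 0 2 k + (K 1 0 k + K 1 2 k) + (K 2 0 k + K 2 2 k)
      + (K 3 0 k + K 3 2 k) = 0)
    (h25 : ∀ k, K 0 2 k + K 0 5 k + (K 1 2 k + K 1 5 k) + (K 2 2 k + K 2 5 k)
      + (K 3 2 k + K 3 5 k) = 0) (i : Fin 4) (k l : Fin 6) : K i k l = 0 := by
  -- The last hypotheses say that Kᵢ has the plane of ωᵢ in its kernel, while K₀ + K₁ + K₂ + K₃ has
  -- the plane of ω₄ in its kernel. With Kᵢ(ωⱼ) = 0 they leave no freedom in the 4 · 15 entries.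
  have hd (i k) : K i k k = 0 := by linear_combination (1 / 2 : ℂ) * hs i k k
  suffices H : ∀ i, K i 0 1 = 0 ∧ K i 0 2 = 0 ∧ K i 0 3 = 0 ∧ K i 0 4 = 0 ∧ K i 0 5 = 0 ∧
      K i 1 2 = 0 ∧ K i 1 3 = 0 ∧ K i 1 4 = 0 ∧ K i 1 5 = 0 ∧ K i 2 3 = 0 ∧ K i 2 4 = 0 ∧
      K i 2 5 = 0 ∧ K i 3 4 = 0 ∧ K i 3 5 = 0 ∧ K i 4 5 = 0 by
    obtain ⟨a1, a2, a3, a4, a5, a6, a7, a8, a9, a10, a11, a12, a13, a14, a15⟩ := H i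
    have hlt (k l) (hkl : k < l) : K i k l = 0 := by
      fin_cases k <;> fin_cases l <;> first | assumption | exact absurd hkl (by decide)
    rcases lt_trichotomy k l with h | h | h
    · exact hlt k l h
    · rw [h, hd]
    · rw [hs, hlt l k h, neg_zero]
  intro i
  fin_cases i <;> simp only [Fin.zero_eta, Fin.mk_one, Fin.reduceFinMk] <;> grind

end SpecialPoint

/-! ### The space of configurations and an explicit point of it. -/

section Configurations

/-- The coordinates on the space of configurations: four linear combinations of five decomposable
bivectors. -/
abbrev ParamIdx : Type := (Fin 4 × Fin 5) ⊕ (Fin 5 × Fin 6) ⊕ (Fin 5 × Fin 6)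

variable {V : Type*} [AddCommGroup V] [Module ℂ V] (b : Module.Basis (Fin 6) ℂ V)

/-- The first factors of the five decomposable bivectors. -/
noncomputable def leftFactor (x : ParamIdx → ℂ) (j : Fin 5) : V :=
  ∑ k, x (Sum.inr (Sum.inl (j, k))) • b k

/-- The second factors of the five decomposable bivectors. -/
noncomputable def rightFactor (x : ParamIdx → ℂ) (j : Fin 5) : V :=
  ∑ k, x (Sum.inr (Sum.inr (j, k))) • b k

/-- The five decomposable bivectors. -/
noncomputable def biv (x : ParamIdx → ℂ) (j : Fin 5) : ⋀[ℂ]^2 V :=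
  wedge (leftFactor b x j) (rightFactor b x j)

/-- The four linear combinations. -/
noncomputable def comb (x : ParamIdx → ℂ) (i : Fin 4) : ⋀[ℂ]^2 V :=
  ∑ j, x (Sum.inl (i, j)) • biv b x j

/-- The first indices of the pairs of distinct elements of `Fin 5`. -/
def pairFst : Fin 10 → Fin 5 := ![0, 0, 0, 0, 1, 1, 1, 2, 2, 3]

/-- The second indices of the pairs of distinct elements of `Fin 5`. -/
def pairSnd : Fin 10 → Fin 5 := ![1, 2, 3, 4, 2, 3, 4, 3, 4, 4]

/-- The products of two of the five bivectors. -/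
noncomputable def bivProd (x : ParamIdx → ℂ) (p : Fin 10) : Fin 6 × Fin 6 × Fin 6 × Fin 6 → ℂ :=
  bivectorMul b (biv b x (pairFst p)) (biv b x (pairSnd p))

/-- Basis bivectors that complement the span of the special configuration. -/
noncomputable def complementBiv : Fin 10 → ⋀[ℂ]^2 V :=
  ![wedge (b 0) (b 3), wedge (b 0) (b 4), wedge (b 1) (b 2), wedge (b 1) (b 3), wedge (b 1) (b 4),
    wedge (b 1) (b 5), wedge (b 2) (b 4), wedge (b 3) (b 5), wedge (b 0) (b 2), wedge (b 0) (b 5)]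

/-- A configuration at which all genericity conditions hold. -/
def specialParam : ParamIdx → ℂ :=
  Sum.elim
    (fun p => (![![1, 0, 0, 0, -1], ![0, 1, 0, 0, -1], ![0, 0, 1, 0, -1],
      ![0, 0, 0, 1, -1]] : Fin 4 → Fin 5 → ℂ) p.1 p.2)
    (Sum.elim
      (fun p => (![![1, 0, 0, 0, 0, 0], ![0, 0, 1, 0, 0, 0], ![0, 0, 0, 0, 1, 0],
        ![0, 1, 0, 1, 0, 0], ![1, 0, 1, 0, 0, 0]] : Fin 5 → Fin 6 → ℂ) p.1 p.2)
      (fun p => (![![0, 1, 0, 0, 0, 0], ![0, 0, 0, 1, 0, 0], ![0, 0, 0, 0, 0, 1],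
        ![0, 1, 0, 0, 1, 0], ![0, 0, 1, 0, 0, 1]] : Fin 5 → Fin 6 → ℂ) p.1 p.2))

theorem leftFactor_specialParam :
    leftFactor b specialParam = ![b 0, b 2, b 4, b 1 + b 3, b 0 + b 2] := by
  ext j
  fin_cases j <;> simp [leftFactor, specialParam, Fin.sum_univ_six]

theorem rightFactor_specialParam :
    rightFactor b specialParam = ![b 1, b 3, b 5, b 1 + b 4, b 2 + b 5] := by
  ext j
  fin_cases j <;> simp [rightFactor, specialParam, Fin.sum_univ_six]

theorem biv_specialParam :
    biv b specialParam = ![wedge (b 0) (b 1), wedge (b 2) (b 3), wedge (b 4) (b 5),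
      wedge (b 1) (b 4) + wedge (b 3) (b 1) + wedge (b 3) (b 4),
      wedge (b 0) (b 2) + wedge (b 0) (b 5) + wedge (b 2) (b 5)] := by
  funext j
  fin_cases j <;>
    simp [biv, leftFactor_specialParam, rightFactor_specialParam, wedge_self]
  abel

theorem sum_specialParam_smul {E : Type*} [AddCommGroup E] [Module ℂ E] (B : Fin 5 → E)
    (i : Fin 4) : ∑ j, specialParam (Sum.inl (i, j)) • B j = B i.castSucc - B 4 := by
  fin_cases i <;> simp [specialParam, Fin.sum_univ_five, sub_eq_add_neg]

theorem comb_specialParam :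
    comb b specialParam = fun i => biv b specialParam i.castSucc - biv b specialParam 4 :=
  funext fun i => sum_specialParam_smul (biv b specialParam) i

theorem linearIndependent_biv_specialParam :
    LinearIndependent ℂ (Sum.elim (complementBiv b) (biv b specialParam)) := by
  rw [Fintype.linearIndependent_iff]
  intro g hg
  have h (i j : Fin 6) := congrArg (plucker b i j) hg
  simp only [Fintype.sum_sum_type, Sum.elim_inl, Sum.elim_inr, Fin.sum_univ_succ,
    Fin.sum_univ_zero, complementBiv, biv_specialParam, map_add, map_smul, map_zero] at h
  have h01 := h 0 1
  have h02 := h 0 2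
  have h03 := h 0 3
  have h04 := h 0 4
  have h05 := h 0 5
  have h12 := h 1 2
  have h13 := h 1 3
  have h14 := h 1 4
  have h15 := h 1 5
  have h23 := h 2 3
  have h24 := h 2 4
  have h25 := h 2 5
  have h34 := h 3 4
  have h35 := h 3 5
  have h45 := h 4 5
  clear h hg
  simp [plucker_wedge_basis] at h01 h02 h03 h04 h05 h12 h13 h14 h15 h23 h24 h25 h34 h35 h45
  rintro (i | i) <;> fin_cases i <;> simp <;> grind

end Configurations

/-! ### Genericity of the explicit configuration. -/

section SpecialConfiguration

variable {V : Type*} [AddCommGroup V] [Module ℂ V] (b : Module.Basis (Fin 6) ℂ V)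

/-- The differences span the combinations of B with coefficient sum zero, while Bⱼ has coefficient
sum one. -/
theorem linearIndependent_cons_sub {E : Type*} [AddCommGroup E] [Module ℂ E] {B : Fin 5 → E}
    (hB : LinearIndependent ℂ B) (j : Fin 5) :
    LinearIndependent ℂ (Fin.cons (B j) fun i : Fin 4 => B i.castSucc - B 4 : Fin 5 → E) := by
  rw [Fintype.linearIndependent_iff] at hB ⊢
  intro g hg
  simp only [Fin.sum_univ_succ (n := 4), Fin.cons_zero, Fin.cons_succ] at hg
  simp only [Fin.sum_univ_four] at hg
  have h := hB (fun k => g 0 * (if k = j then 1 else 0) +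
    (![g 1, g 2, g 3, g 4, -(g 1 + g 2 + g 3 + g 4)] : Fin 5 → ℂ) k) (by
      rw [← hg]
      simp only [add_smul, Finset.sum_add_distrib, mul_smul, ite_smul, one_smul, zero_smul,
        smul_ite, smul_zero, Finset.sum_ite_eq', Finset.mem_univ, if_true]
      congr 1
      simp [Fin.sum_univ_five, Fin.succ]
      module)
  have h0 := h 0
  have h1 := h 1
  have h2 := h 2
  have h3 := h 3
  have h4 := h 4
  clear hB h hg
  intro i
  fin_cases j <;> simp at h0 h1 h2 h3 h4 <;> fin_cases i <;> simp <;> grind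

theorem linearIndependent_cons_comb_specialParam (j : Fin 5) :
    LinearIndependent ℂ
      (Fin.cons (biv b specialParam j) (comb b specialParam) : Fin 5 → ⋀[ℂ]^2 V) := by
  rw [comb_specialParam]
  exact linearIndependent_cons_sub
    ((linearIndependent_biv_specialParam b).comp Sum.inr Sum.inr_injective) j

/-- Coordinates of the linear combinations of the products in the special configuration. -/
theorem sum_bivProd_specialParam (c : Fin 10 → ℂ) (q : Fin 6 × Fin 6 × Fin 6 × Fin 6 → ℂ)
    (hq : ∑ p, c p • bivProd b specialParam p = q) :
    (q (0, 1, 2, 3) = c 0 + c 9 ∧ q (0, 1, 4, 5) = c 1 + c 9 ∧ q (0, 1, 3, 4) = c 2 ∧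
      q (0, 1, 2, 5) = c 3 ∧ q (2, 3, 4, 5) = c 4 + c 9 ∧ q (1, 2, 3, 4) = c 5 ∧
      q (0, 2, 3, 5) = c 6 ∧ q (1, 3, 4, 5) = -c 7 ∧ q (0, 2, 4, 5) = c 8) ∧
    (q (0, 1, 2, 4) = -c 9 ∧ q (1, 2, 4, 5) = -c 9 ∧ q (0, 1, 3, 5) = -c 9 ∧
      q (1, 2, 3, 5) = c 9 ∧ q (0, 2, 3, 4) = c 9 ∧ q (0, 3, 4, 5) = c 9) := by
  subst hq
  simp only [Fin.sum_univ_succ, Fin.sum_univ_zero, bivProd, pairFst, pairSnd, biv_specialParam]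
  -- Of the fifteen coordinates on ⋀⁴V, the last six all equal ±c₉. This yields five linear
  -- equations, which cut out the span of the ten products.
  refine ⟨⟨?_, ?_, ?_, ?_, ?_, ?_, ?_, ?_, ?_⟩, ?_, ?_, ?_, ?_, ?_, ?_⟩ <;>
    simp [bivectorMul_apply, plucker_wedge_basis]

theorem linearIndependent_bivProd_specialParam :
    LinearIndependent ℂ (bivProd b specialParam) := by
  rw [Fintype.linearIndependent_iff]
  intro g hg
  obtain ⟨⟨h0, h1, h2, h3, h4, h5, h6, h7, h8⟩, -, -, -, h9, -⟩ :=
    sum_bivProd_specialParam b g 0 hg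
  simp only [Pi.zero_apply] at h0 h1 h2 h3 h4 h5 h6 h7 h8 h9
  intro i
  fin_cases i <;> simp <;> grind

/-- The multiplications by the spanning vectors, and the products supported at one index. -/
noncomputable def multFamily (x : ParamIdx → ℂ) :
    Fin 10 ⊕ Fin 4 × Fin 10 → Fin 4 → Fin 6 × Fin 6 × Fin 6 × Fin 6 → ℂ :=
  Sum.elim (fun k i => bivectorMul b (complementBiv b k) (comb b x i))
    (fun p => Pi.single p.1 (bivProd b x p.2))

/-- This encodes `saturated`: a relation says that a combination θ of the complementary bivectors
multiplies every wᵢ into the span of the products. The equations of that span force θ = 0, and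
independence of the products kills the other coefficients. -/
theorem linearIndependent_multFamily_specialParam :
    LinearIndependent ℂ (multFamily b specialParam) := by
  rw [Fintype.linearIndependent_iff]
  intro g hg
  set θ : ⋀[ℂ]^2 V := ∑ k, g (Sum.inl k) • complementBiv b k with hθ
  have hi (i : Fin 4) : ∑ p, (-g (Sum.inr (i, p))) • bivProd b specialParam p =
      bivectorMul b θ (comb b specialParam i) := by
    have h := congrFun hg i
    rw [Fintype.sum_sum_type, Fintype.sum_prod_type] at h
    simp only [multFamily, Sum.elim_inl, Sum.elim_inr, Pi.add_apply, Finset.sum_apply,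
      Pi.smul_apply, Pi.zero_apply] at h
    rw [Finset.sum_eq_single (f := fun j => ∑ p, g (Sum.inr (j, p)) •
      (Pi.single j (bivProd b specialParam p) : Fin 4 → _) i) i
      (fun j _ hj => Finset.sum_eq_zero fun p _ => by rw [Pi.single_eq_of_ne hj.symm, smul_zero])
      (by simp)] at h
    simp only [Pi.single_eq_same] at h
    simp only [hθ, map_sum, map_smul, LinearMap.sum_apply, LinearMap.smul_apply, neg_smul,
      Finset.sum_neg_distrib]
    exact (eq_neg_of_add_eq_zero_left h).symm
  have hrel (i : Fin 4) := (sum_bivProd_specialParam b _ _ (hi i)).2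
  have hθ0 : ∀ k, g (Sum.inl k) = 0 := by
    have hp (i j : Fin 6) : plucker b i j θ =
        ∑ k, g (Sum.inl k) * plucker b i j (complementBiv b k) := by
      simp [hθ]
    have h01 := hp 0 1
    have h02 := hp 0 2
    have h03 := hp 0 3
    have h04 := hp 0 4
    have h05 := hp 0 5
    have h12 := hp 1 2
    have h13 := hp 1 3
    have h14 := hp 1 4
    have h15 := hp 1 5
    have h23 := hp 2 3
    have h24 := hp 2 4
    have h25 := hp 2 5
    have h34 := hp 3 4
    have h35 := hp 3 5
    have h45 := hp 4 5
    simp [Fin.sum_univ_succ, complementBiv, plucker_wedge_basis]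
      at h01 h02 h03 h04 h05 h12 h13 h14 h15 h23 h24 h25 h34 h35 h45
    have hr0 := hrel 0
    have hr1 := hrel 1
    have hr2 := hrel 2
    have hr3 := hrel 3
    clear hi hg hrel hp
    simp only [comb_specialParam, biv_specialParam, bivectorMul_apply, h01, h02, h03, h04, h05, h12,
      h13, h14, h15, h23, h24, h25, h34, h35, h45] at hr0 hr1 hr2 hr3
    simp [plucker_wedge_basis] at hr0 hr1 hr2 hr3
    intro k
    fin_cases k <;> simp <;> grind
  have hθz : θ = 0 := by simp [hθ, hθ0]
  rintro (k | ⟨i, p⟩)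
  · exact hθ0 k
  · have := Fintype.linearIndependent_iff.1 (linearIndependent_bivProd_specialParam b) _
      ((hi i).trans (by rw [hθz]; simp)) p
    simpa using this

end SpecialConfiguration

/-! ### Genericity as an open condition on configurations. -/

section GenericConfigurations

variable {V : Type*} [AddCommGroup V] [Module ℂ V] (b : Module.Basis (Fin 6) ℂ V)

theorem isPolyMap_leftFactor (j : Fin 5) : IsPolyMap (fun x => leftFactor b x j) :=
  IsPolyMap.sum fun k _ => IsPolyMap.smul (coord_mem_polyFun _) (IsPolyMap.const (b k))

theorem isPolyMap_rightFactor (j : Fin 5) : IsPolyMap (fun x => rightFactor b x j) :=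
  IsPolyMap.sum fun k _ => IsPolyMap.smul (coord_mem_polyFun _) (IsPolyMap.const (b k))

theorem isPolyMap_biv (j : Fin 5) : IsPolyMap (fun x => biv b x j) :=
  have := Module.Finite.of_basis b
  (isPolyMap_leftFactor b j).bilin (isPolyMap_rightFactor b j) wedge

theorem isPolyMap_comb (i : Fin 4) : IsPolyMap (fun x => comb b x i) :=
  IsPolyMap.sum fun j _ => IsPolyMap.smul (coord_mem_polyFun _) (isPolyMap_biv b j)

theorem isPolyMap_bivProd (p : Fin 10) : IsPolyMap (fun x => bivProd b x p) :=
  have := Module.Finite.of_basis b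
  (isPolyMap_biv b _).bilin (isPolyMap_biv b _) (bivectorMul b)

theorem isPolyMap_multFamily (k : Fin 10 ⊕ Fin 4 × Fin 10) :
    IsPolyMap (fun x => multFamily b x k) := by
  rcases k with k | p
  · exact IsPolyMap.pi fun i => (isPolyMap_comb b i).comp_linearMap _
  · exact (isPolyMap_bivProd b p.2).comp_linearMap 
      (LinearMap.single ℂ (fun _ : Fin 4 => Fin 6 × Fin 6 × Fin 6 × Fin 6 → ℂ) p.1)

theorem bivectorMul_biv_mem_span (x : ParamIdx → ℂ) (j k : Fin 5) :
    bivectorMul b (biv b x j) (biv b x k) ∈ Submodule.span ℂ (Set.range (bivProd b x)) := by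
  have hlt (p : Fin 10) : bivectorMul b (biv b x (pairFst p)) (biv b x (pairSnd p)) ∈
      Submodule.span ℂ (Set.range (bivProd b x)) := Submodule.subset_span ⟨p, rfl⟩
  rcases eq_or_ne j k with rfl | hjk
  · rw [biv, bivectorMul_wedge_self]
    exact Submodule.zero_mem _
  · have : ∃ p, pairFst p = j ∧ pairSnd p = k ∨ pairFst p = k ∧ pairSnd p = j := by
      revert j k; decide
    obtain ⟨p, ⟨rfl, rfl⟩ | ⟨rfl, rfl⟩⟩ := this
    · exact hlt p
    · rw [bivectorMul_comm]
      exact hlt p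

theorem finrank_bivectors (b : Module.Basis (Fin 6) ℂ V) : Module.finrank ℂ (⋀[ℂ]^2 V) = 15 := by
  have := Module.Finite.of_basis b
  rw [exteriorPower.finrank_eq, Module.finrank_eq_card_basis b]
  rfl

/-- All conditions are reduced to independence of families polynomial in x. For `saturated`, the
fifteen vectors of `hbiv` form a basis of ⋀²V; the part of θ along the ωⱼ multiplies each wᵢ into
the span of the products anyway, and `hmult` kills the complementary part. -/
theorem isGeneric_of_linearIndependent {x : ParamIdx → ℂ}
    (hbiv : LinearIndependent ℂ (Sum.elim (complementBiv b) (biv b x)))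
    (hcons : ∀ j, LinearIndependent ℂ (Fin.cons (biv b x j) (comb b x) : Fin 5 → ⋀[ℂ]^2 V))
    (hprod : LinearIndependent ℂ (bivProd b x)) (hmult : LinearIndependent ℂ (multFamily b x)) :
    IsGeneric (bivectorMul b) (biv b x) (comb b x) where
  products c hc h0 := by
    have hd (j) : bivectorMul b (biv b x j) (biv b x j) = 0 := bivectorMul_wedge_self b _ _
    have hs (j k) : bivectorMul b (biv b x j) (biv b x k) =
        bivectorMul b (biv b x k) (biv b x j) := bivectorMul_comm b _ _
    have h := Fintype.linearIndependent_iff.1 hprod (fun p => c (pairFst p) (pairSnd p)) (by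
      -- The symmetric double sum counts each pair twice, and its diagonal terms vanish.
      have h2 : (2 : ℂ) • ∑ p, c (pairFst p) (pairSnd p) • bivProd b x p = 0 := by
        rw [← h0]
        simp only [Fin.sum_univ_five, Fin.sum_univ_succ (n := 9), Fin.sum_univ_succ (n := 8),
          Fin.sum_univ_succ (n := 7), Fin.sum_univ_succ (n := 6), Fin.sum_univ_succ (n := 5),
          bivProd, pairFst, pairSnd, hd, hs 1 0, hs 2 0, hs 3 0, hs 4 0, hs 2 1, hs 3 1, hs 4 1,
          hs 3 2, hs 4 2, hs 4 3, hc 1 0, hc 2 0, hc 3 0, hc 4 0, hc 2 1, hc 3 1, hc 4 1,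
          hc 3 2, hc 4 2, hc 4 3]
        simp
        module
      exact (smul_eq_zero.1 h2).resolve_left two_ne_zero)
    intro j k hjk
    have : ∃ p, pairFst p = j ∧ pairSnd p = k ∨ pairFst p = k ∧ pairSnd p = j := by
      revert j k; decide
    obtain ⟨p, ⟨rfl, rfl⟩ | ⟨rfl, rfl⟩⟩ := this
    · exact h p
    · rw [hc]
      exact h p
  indep := hbiv.comp Sum.inr Sum.inr_injective
  indep_sub := by
    have := (hcons 0).comp Fin.succ (Fin.succ_injective _)
    simpa [Function.comp_def] using this
  mem i := Submodule.sum_mem _ fun j _ => Submodule.smul_mem _ _ (Submodule.subset_span ⟨j, rfl⟩)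
  notMem j := (linearIndependent_finCons.1 (hcons j)).2
  saturated θ hθ := by
    have hle : Submodule.span ℂ (Set.range fun p : Fin 5 × Fin 5 =>
        bivectorMul b (biv b x p.1) (biv b x p.2)) ≤
        Submodule.span ℂ (Set.range (bivProd b x)) := by
      rw [Submodule.span_le]
      rintro _ ⟨p, rfl⟩
      exact bivectorMul_biv_mem_span b x _ _
    have htop := hbiv.span_eq_top_of_card_eq_finrank (by rw [finrank_bivectors b]; rfl)
    have hmem : θ ∈ Submodule.span ℂ (Set.range (Sum.elim (complementBiv b) (biv b x))) :=
      htop ▸ Submodule.mem_top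
    obtain ⟨g, hg⟩ := (Submodule.mem_span_range_iff_exists_fun ℂ).1 hmem
    rw [Fintype.sum_sum_type] at hg
    simp only [Sum.elim_inl, Sum.elim_inr] at hg
    have hi (i : Fin 4) : ∃ q : Fin 10 → ℂ, ∑ p, q p • bivProd b x p =
        ∑ k, g (Sum.inl k) • bivectorMul b (complementBiv b k) (comb b x i) := by
      rw [← Submodule.mem_span_range_iff_exists_fun ℂ]
      have h1 := hle (hθ i)
      rw [← hg] at h1
      simp only [map_add, map_sum, map_smul, LinearMap.add_apply, LinearMap.sum_apply,
        LinearMap.smul_apply] at h1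
      refine (Submodule.add_mem_iff_left _ ?_).1 h1
      refine Submodule.sum_mem _ fun j _ => Submodule.smul_mem _ _ ?_
      rw [comb, map_sum]
      refine Submodule.sum_mem _ fun k _ => ?_
      rw [map_smul]
      exact Submodule.smul_mem _ _ (bivectorMul_biv_mem_span b x _ _)
    choose q hq using hi
    have hz := Fintype.linearIndependent_iff.1 hmult
      (Sum.elim (fun k => g (Sum.inl k)) fun p => -q p.1 p.2) (by
        rw [Fintype.sum_sum_type, Fintype.sum_prod_type]
        simp only [multFamily, Sum.elim_inl, Sum.elim_inr]
        funext i
        simp only [Pi.add_apply, Finset.sum_apply, Pi.smul_apply, Pi.zero_apply]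
        rw [Finset.sum_eq_single (f := fun j => ∑ p, -q j p •
          (Pi.single j (bivProd b x p) : Fin 4 → _) i) i
          (fun j _ hj => Finset.sum_eq_zero fun p _ => by
            rw [Pi.single_eq_of_ne hj.symm, smul_zero])
          (by simp)]
        simp only [Pi.single_eq_same, neg_smul, Finset.sum_neg_distrib, hq, add_neg_cancel])
    rw [← hg, Finset.sum_eq_zero (s := Finset.univ) (f := fun k => g (Sum.inl k) • _) fun k _ => by
      rw [show g (Sum.inl k) = 0 from hz (Sum.inl k), zero_smul], zero_add]
    exact Submodule.sum_mem _ fun j _ => Submodule.smul_mem _ _ (Submodule.subset_span ⟨j, rfl⟩)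

/-- The generic configuration satisfies the genericity conditions. -/
theorem exists_polynomial_isGeneric : ∃ N : MvPolynomial ParamIdx ℂ,
    MvPolynomial.eval specialParam N ≠ 0 ∧
      ∀ x, MvPolynomial.eval x N ≠ 0 → IsGeneric (bivectorMul b) (biv b x) (comb b x) := by
  obtain ⟨N₁, h₁, hN₁⟩ := IsPolyMap.exists_linearIndependent
    (v := fun i x => Sum.elim (complementBiv b) (biv b x) i) (by
      rintro (k | j)
      · exact IsPolyMap.const _
      · exact isPolyMap_biv b j) (linearIndependent_biv_specialParam b)
  have hcons (j : Fin 5) := IsPolyMap.exists_linearIndependent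
    (v := fun i x => (Fin.cons (biv b x j) (comb b x) : Fin 5 → ⋀[ℂ]^2 V) i) (by
      intro i
      refine Fin.cases ?_ (fun i => ?_) i
      · exact isPolyMap_biv b j
      · exact isPolyMap_comb b i) (linearIndependent_cons_comb_specialParam b j)
  choose N₂ h₂ hN₂ using hcons
  obtain ⟨N₃, h₃, hN₃⟩ := IsPolyMap.exists_linearIndependent
    (isPolyMap_bivProd b) (linearIndependent_bivProd_specialParam b)
  obtain ⟨N₄, h₄, hN₄⟩ := IsPolyMap.exists_linearIndependent
    (isPolyMap_multFamily b) (linearIndependent_multFamily_specialParam b)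
  refine ⟨N₁ * (∏ j, N₂ j) * N₃ * N₄, ?_, fun x hx => ?_⟩
  · simp only [map_mul, map_prod]
    exact mul_ne_zero (mul_ne_zero (mul_ne_zero h₁ (Finset.prod_ne_zero_iff.2 fun j _ => h₂ j)) h₃)
      h₄
  · simp only [map_mul, map_prod, mul_ne_zero_iff, Finset.prod_ne_zero_iff] at hx
    obtain ⟨⟨⟨hx₁, hx₂⟩, hx₃⟩, hx₄⟩ := hx
    exact isGeneric_of_linearIndependent b (hN₁ x hx₁)
      (fun j => hN₂ j x (hx₂ j (Finset.mem_univ j))) (hN₃ x hx₃) (hN₄ x hx₄)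

end GenericConfigurations

/-! ### Submersion at the special configuration, and dominance. -/

section Dominance

variable {V : Type*} [AddCommGroup V] [Module ℂ V] (b : Module.Basis (Fin 6) ℂ V)

theorem leftFactor_add_smul (x y : ParamIdx → ℂ) (t : ℂ) (j : Fin 5) :
    leftFactor b (x + t • y) j = leftFactor b x j + t • leftFactor b y j := by
  simp only [leftFactor, Pi.add_apply, Pi.smul_apply, smul_eq_mul, add_smul, mul_smul,
    Finset.sum_add_distrib, Finset.smul_sum]

theorem rightFactor_add_smul (x y : ParamIdx → ℂ) (t : ℂ) (j : Fin 5) :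
    rightFactor b (x + t • y) j = rightFactor b x j + t • rightFactor b y j := by
  simp only [rightFactor, Pi.add_apply, Pi.smul_apply, smul_eq_mul, add_smul, mul_smul,
    Finset.sum_add_distrib, Finset.smul_sum]

/-- A linear functional that vanishes on the image of the derivative vanishes on the velocity of
every line that is mapped to a line. -/
theorem apply_eq_zero_of_affine {X Y : Type*} [NormedAddCommGroup X] [NormedSpace ℂ X]
    [NormedAddCommGroup Y] [NormedSpace ℂ Y] {G : X → Y} {x y : X} {D : Y}
    (hG : DifferentiableAt ℂ G x) (hD : ∀ t : ℂ, G (x + t • y) = G x + t • D)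
    {Λ : Module.Dual ℂ Y} (hΛ : (fderiv ℂ G x).range ≤ LinearMap.ker Λ) : Λ D = 0 := by
  have h1 : HasLineDerivAt ℂ G D x y := by
    have : HasDerivAt (fun t : ℂ => G x + t • D) D 0 := by
      simpa using ((hasDerivAt_id (0 : ℂ)).smul_const D).const_add (G x)
    exact this.congr_of_eventuallyEq (Filter.Eventually.of_forall hD)
  have h2 : fderiv ℂ G x y = D := by
    rw [← hG.lineDeriv_eq_fderiv]
    exact h1.lineDeriv
  exact hΛ ⟨y, h2⟩

theorem eq_zero_of_annihilates_derivative (κ : Fin 4 → Module.Dual ℂ (⋀[ℂ]^2 V))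
    (h₁ : ∀ i j, κ i (biv b specialParam j) = 0)
    (h₂ : ∀ j k, ∑ i, specialParam (Sum.inl (i, j)) *
      κ i (wedge (b k) (rightFactor b specialParam j)) = 0)
    (h₃ : ∀ j k, ∑ i, specialParam (Sum.inl (i, j)) *
      κ i (wedge (leftFactor b specialParam j) (b k)) = 0) (i : Fin 4) : κ i = 0 := by
  refine dual_eq_zero_of_wedge_basis b ?_
  have hs (i k l) : κ i (wedge (b k) (b l)) = -κ i (wedge (b l) (b k)) := by
    rw [wedge_swap, map_neg]
  simp only [biv_specialParam, rightFactor_specialParam, leftFactor_specialParam] at h₁ h₂ h₃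
  simp only [specialParam, Sum.elim_inl, Fin.sum_univ_four] at h₂ h₃
  have a0 := fun i => h₁ i 0
  have a1 := fun i => h₁ i 1
  have a2 := fun i => h₁ i 2
  have a3 := fun i => h₁ i 3
  have a4 := fun i => h₁ i 4
  have b0 := h₂ 0
  have b1 := h₂ 1
  have b2 := h₂ 2
  have b3 := h₂ 3
  have b4 := h₂ 4
  have c0 := h₃ 0
  have c1 := h₃ 1
  have c2 := h₃ 2
  have c3 := h₃ 3
  have c4 := h₃ 4
  clear h₁ h₂ h₃
  simp at a0 a1 a2 a3 a4 b0 b1 b2 b3 b4 c0 c1 c2 c3 c4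
  exact eq_zero_of_annihilates_tangent (K := fun i k l => κ i (wedge (b k) (b l))) hs a0 a1 a2 a3 a4
    c0 (fun k => (hs 0 1 k).trans (by rw [b0, neg_zero]))
    c1 (fun k => (hs 1 3 k).trans (by rw [b1, neg_zero]))
    c2 (fun k => (hs 2 5 k).trans (by rw [b2, neg_zero]))
    c3 (fun k => by linear_combination hs 3 1 k + hs 3 4 k - b3 k)
    (fun k => by linear_combination -c4 k)
    (fun k => by
      linear_combination hs 0 2 k + hs 0 5 k + hs 1 2 k + hs 1 5 k + hs 2 2 k + hs 2 5 k
        + hs 3 2 k + hs 3 5 k + b4 k) i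

theorem leftFactor_single (j j' : Fin 5) (k : Fin 6) :
    leftFactor b (Pi.single (Sum.inr (Sum.inl (j, k))) 1) j' = if j' = j then b k else 0 := by
  simp only [leftFactor, Pi.single_apply, Sum.inr.injEq, Sum.inl.injEq, Prod.mk.injEq, ite_smul,
    one_smul, zero_smul]
  by_cases h : j' = j <;> simp [h]

theorem rightFactor_single (j j' : Fin 5) (k : Fin 6) :
    rightFactor b (Pi.single (Sum.inr (Sum.inr (j, k))) 1) j' = if j' = j then b k else 0 := by
  simp only [rightFactor, Pi.single_apply, Sum.inr.injEq, Prod.mk.injEq, ite_smul,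
    one_smul, zero_smul]
  by_cases h : j' = j <;> simp [h]

/-- By multilinearity `comb` is affine in each single coordinate, so velocities along coordinate
lines are read off exactly. This and the next two lemmas treat the three kinds of coordinates. -/
theorem comb_add_single_inl (x : ParamIdx → ℂ) (t : ℂ) (i : Fin 4) (j : Fin 5) :
    comb b (x + t • Pi.single (Sum.inl (i, j)) 1) =
      comb b x + t • (Pi.single i (biv b x j) : Fin 4 → ⋀[ℂ]^2 V) := by
  have hl (j') : leftFactor b (Pi.single (Sum.inl (i, j)) 1) j' = 0 := by simp [leftFactor]
  have hr (j') : rightFactor b (Pi.single (Sum.inl (i, j)) 1) j' = 0 := by simp [rightFactor]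
  funext i'
  simp only [comb, biv, leftFactor_add_smul, rightFactor_add_smul, hl, hr, smul_zero, add_zero,
    Pi.add_apply, Pi.smul_apply, smul_eq_mul, add_smul, Finset.sum_add_distrib]
  congr 1
  by_cases h : i' = i
  · subst h
    simp [Pi.single_apply, ite_smul]
  · simp [h]

theorem comb_add_single_inr_inl (x : ParamIdx → ℂ) (t : ℂ) (j : Fin 5) (k : Fin 6) :
    comb b (x + t • Pi.single (Sum.inr (Sum.inl (j, k))) 1) =
      comb b x + t • fun i => x (Sum.inl (i, j)) • wedge (b k) (rightFactor b x j) := by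
  have hr (j') : rightFactor b (Pi.single (Sum.inr (Sum.inl (j, k))) 1) j' = 0 := by
    simp [rightFactor]
  funext i'
  have ha (j') : (x + t • Pi.single (Sum.inr (Sum.inl (j, k))) 1 : ParamIdx → ℂ) (Sum.inl (i', j')) =
      x (Sum.inl (i', j')) := by simp
  simp only [comb, biv, leftFactor_add_smul, rightFactor_add_smul, leftFactor_single, hr, ha,
    smul_zero, add_zero, map_add, map_smul, LinearMap.add_apply, LinearMap.smul_apply, smul_add,
    Finset.sum_add_distrib, Pi.add_apply, Pi.smul_apply]
  congr 1
  rw [Finset.sum_eq_single j (fun j' _ hj => by simp [hj]) (by simp)]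
  simp only [if_true]
  rw [smul_comm]

theorem comb_add_single_inr_inr (x : ParamIdx → ℂ) (t : ℂ) (j : Fin 5) (k : Fin 6) :
    comb b (x + t • Pi.single (Sum.inr (Sum.inr (j, k))) 1) =
      comb b x + t • fun i => x (Sum.inl (i, j)) • wedge (leftFactor b x j) (b k) := by
  have hl (j') : leftFactor b (Pi.single (Sum.inr (Sum.inr (j, k))) 1) j' = 0 := by
    simp [leftFactor]
  funext i'
  have ha (j') : (x + t • Pi.single (Sum.inr (Sum.inr (j, k))) 1 : ParamIdx → ℂ) (Sum.inl (i', j')) =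
      x (Sum.inl (i', j')) := by simp
  simp only [comb, biv, leftFactor_add_smul, rightFactor_add_smul, rightFactor_single, hl, ha,
    smul_zero, add_zero, map_add, map_smul, smul_add,
    Finset.sum_add_distrib, Pi.add_apply, Pi.smul_apply]
  congr 1
  rw [Finset.sum_eq_single j (fun j' _ hj => by simp [hj]) (by simp)]
  simp only [if_true]
  rw [smul_comm]

/-- In linear coordinates `c`, the map that sends a configuration to its four linear combinations is
a submersion at the special configuration. -/
theorem range_fderiv_comb {n : ℕ} (c : (Fin 4 → ⋀[ℂ]^2 V) ≃ₗ[ℂ] (Fin n → ℂ))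
    (hd : DifferentiableAt ℂ (fun x => c (comb b x)) specialParam) :
    (fderiv ℂ (fun x => c (comb b x)) specialParam).range = ⊤ := by
  by_contra hne
  -- A functional killing the image of the derivative amounts to four forms κᵢ on ⋀²V, and the
  -- coordinate velocities impose on them exactly the linear system solved above.
  obtain ⟨Λ, hΛ0, hΛ⟩ := Submodule.exists_le_ker_of_lt_top _ (lt_top_iff_ne_top.2 hne)
  have hvel {y : ParamIdx → ℂ} {D : Fin 4 → ⋀[ℂ]^2 V}
      (hD : ∀ t : ℂ, comb b (specialParam + t • y) = comb b specialParam + t • D) :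
      Λ (c D) = 0 :=
    apply_eq_zero_of_affine hd (fun t => (congrArg c (hD t)).trans (by simp)) hΛ
  have hsum (D : Fin 4 → ⋀[ℂ]^2 V) : Λ (c D) = ∑ i, Λ (c (Pi.single i (D i))) := by
    rw [← map_sum, ← map_sum, Finset.univ_sum_single]
  have hκ := eq_zero_of_annihilates_derivative b
    (fun i => Λ ∘ₗ c.toLinearMap ∘ₗ LinearMap.single ℂ (fun _ : Fin 4 => ⋀[ℂ]^2 V) i)
    (fun i j => hvel fun t => comb_add_single_inl b _ t i j)
    (fun j k => by
      have := hvel fun t => comb_add_single_inr_inl b _ t j k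
      rw [hsum] at this
      simpa [Pi.single_smul] using this)
    (fun j k => by
      have := hvel fun t => comb_add_single_inr_inr b _ t j k
      rw [hsum] at this
      simpa [Pi.single_smul] using this)
  refine hΛ0 (LinearMap.ext fun z => ?_)
  obtain ⟨D, rfl⟩ := c.surjective z
  rw [hsum, LinearMap.zero_apply]
  exact Finset.sum_eq_zero fun i _ => LinearMap.congr_fun (hκ i) (D i)

/-- Outside a hypersurface, four bivectors are the linear combinations of a generic
configuration. -/
theorem exists_polynomial_exists_isGeneric : ∃ (n : ℕ)
    (c : (Fin 4 → ⋀[ℂ]^2 V) ≃ₗ[ℂ] (Fin n → ℂ)) (f : MvPolynomial (Fin n) ℂ), f ≠ 0 ∧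
      ∀ w, MvPolynomial.eval (c w) f ≠ 0 →
        ∃ x, comb b x = w ∧ IsGeneric (bivectorMul b) (biv b x) (comb b x) := by
  have := Module.Finite.of_basis b
  let c := (Module.finBasis ℂ (Fin 4 → ⋀[ℂ]^2 V)).equivFun
  obtain ⟨N, hN₀, hN⟩ := exists_polynomial_isGeneric b
  have hpoly : IsPolyMap (comb b) := IsPolyMap.pi fun i => isPolyMap_comb b i
  choose F hF using fun t => mem_polyFun_iff.1 (hpoly (LinearMap.proj t ∘ₗ c.toLinearMap))
  have hFc : (fun x t => MvPolynomial.eval x (F t)) = fun x => c (comb b x) := by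
    funext x t
    exact hF t x
  have hd : DifferentiableAt ℂ (fun x => c (comb b x)) specialParam := by
    rw [← hFc]
    exact ((contDiff_pi.2 fun t => contDiff_eval (F t)).differentiable one_ne_zero) _
  obtain ⟨f, hf, h⟩ := exists_open_subset_image_of_fderiv_surjective F N specialParam hN₀ (by
    rw [hFc]
    exact range_fderiv_comb b c hd)
  refine ⟨_, c, f, hf, fun w hw => ?_⟩
  obtain ⟨x, hx, hxw⟩ := h _ hw
  exact ⟨x, c.injective (funext fun t => (hF t x).symm.trans (hxw t)), hN x hx⟩

end Dominance

end Secant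

/-! ### The theorem, from dominance and uniqueness. -/

theorem mainTheorem3 {V : Type*} [AddCommGroup V] [Module ℂ V]
    (hV : Module.finrank ℂ V = 6) :
    Secant.ForGeneral 4 (⋀[ℂ]^2 V) (fun W₄ =>
      (∃! W₅ : Secant.Gr 5 (⋀[ℂ]^2 V), W₄.1 ≤ W₅.1 ∧ W₅ ∈ Secant.fiveSecant V) ∧
      Disjoint (Secant.projOf W₄.1) (Secant.pluckerGr V) ∧
      ∃! y : ℙ ℂ ((⋀[ℂ]^2 V) ⧸ W₄.1),
        {x : {x : ℙ ℂ (⋀[ℂ]^2 V) // x ∉ Secant.projOf W₄.1} |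
          x.1 ∈ Secant.pluckerGr V ∧ Secant.projectFrom W₄.1 x = y}.encard = 5) := by
  have : FiniteDimensional ℂ V := FiniteDimensional.of_finrank_pos (by omega)
  let b : Module.Basis (Fin 6) ℂ V := Module.finBasisOfFinrankEq ℂ V hV
  obtain ⟨n, c, f, hf, h⟩ := Secant.exists_polynomial_exists_isGeneric b
  have hgen (w) (hw : MvPolynomial.eval (c w) f ≠ 0) :
      ∃ x, Secant.IsGeneric (Secant.bivectorMul b) (Secant.biv b x) w := by
    obtain ⟨x, hx, hg⟩ := h w hw
    exact ⟨x, hx ▸ hg⟩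
  refine Secant.forGeneral_of_eval_ne_zero c.toLinearMap f (fun w hw => ?_) (fun w hw => ?_) ?_
  · obtain ⟨x, hx⟩ := hgen w hw
    exact hx.indep_sub
  · obtain ⟨x, hx⟩ := hgen w hw
    have hG : ∀ y ∈ Secant.pluckerGr V, Secant.bivectorMul b y.rep y.rep = 0 :=
      fun y hy => Secant.bivectorMul_rep_of_mem_pluckerGr b hy
    have hω (j) : hx.point j ∈ Secant.pluckerGr V := Secant.mk_wedge_mem_pluckerGr _ _ _
    have hm := Secant.bivectorMul_comm b
    exact ⟨hx.existsUnique_fiveSecant hm hG hω, hx.disjoint hG, hx.existsUnique_fibre hm hG hω⟩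
  · by_contra! h0
    refine hf (MvPolynomial.funext fun y => ?_)
    have := h0 (c.symm y)
    simpa using this
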